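/- All graphs and multigraphs are finite; graphs are simple, multigraphs may have loops and parallel edges. For a graph or multigraph $H$ write $|H|$ for its number of vertices and $\|H\|$ for its number of edges. Let $M$ be a connected multigraph (with at least one vertex) and let $G$ be a graph. An $M$-subdivision in $G$ is a subgraph of $G$ that is a copy of a graph obtained from $M$ by subdividing each edge $0$ or more times; it is maximum if no $M$-subdivision in $G$ has more edges. Let $\mathcal L(M,G)$ be the set of maximum $M$-subdivisions in $G$, and let $\tau(M,G)$ be the minimum size of a set $S\subseteq V(G)$ that meets the vertex set of every $Q\in\mathcal L(M,G)$. Suppose that $\mathcal L(M,G)$ is pairwise intersecting, that is, any two of its members have a common vertex. If $|G|>\|M\|^3$, then $$\tau(M,G)\le\max\{5|G|^{2/3},\,2\|M\|^2|G|^{1/3}\}.$$ In particular, if $|G|\ge\|M\|^6$, then $\tau(M,G)\le 5|G|^{2/3}$. Moreover (the case $M=K_2$), every connected graph $G$ on $n$ vertices has a set $S\subseteq V(G)$ with $|S|\le 5n^{2/3}$ such that every longest path of $G$ contains a vertex of $S$. -/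

import Mathlib

namespace MSub

variable {α β V : Type*}

/-- A multigraph (loops and parallel edges allowed) is connected if it has a vertex and any two of
its vertices are joined by a walk. -/
def IsConnected (M : Graph α β) : Prop :=
  M.vertexSet.Nonempty ∧
    ∀ x ∈ M.vertexSet, ∀ y ∈ M.vertexSet, Relation.ReflTransGen M.Adj x y

/-- A copy in the simple graph `G` of a graph obtained from the multigraph `M` by subdividing each
edge zero or more times. The vertices of `M` go to distinct branch vertices of `G`; each edge of
`M` is replaced by a path of `G` joining the branch vertices of its two ends (by a cycle through
the branch vertex if the edge is a loop); the replacements pass through no other branch vertices,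
and replacements of distinct edges share no edges and no vertices except branch vertices. -/
structure Subdivision (M : Graph α β) (G : SimpleGraph V) where
  /-- The branch vertices. -/
  branch : M.vertexSet → V
  branch_injective : Function.Injective branch
  /-- One end of each edge (a choice of orientation, used only to write down the walks). -/
  tail : M.edgeSet → M.vertexSet
  /-- The other end of each edge. -/
  head : M.edgeSet → M.vertexSet
  isLink : ∀ e : M.edgeSet, M.IsLink e (tail e) (head e)
  /-- The subdivided edge. -/
  route : ∀ e, G.Walk (branch (tail e)) (branch (head e))
  isPath_of_ne : ∀ e, tail e ≠ head e → (route e).IsPath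
  isCycle_of_eq : ∀ e (h : tail e = head e),
    ((route e).copy rfl (congrArg branch h.symm)).IsCycle
  branch_mem_route : ∀ e x, branch x ∈ (route e).support → x = tail e ∨ x = head e
  route_inter_route : ∀ e f, e ≠ f → ∀ v, v ∈ (route e).support → v ∈ (route f).support →
    v ∈ Set.range branch
  edges_disjoint : ∀ e f, e ≠ f → (route e).edges.Disjoint (route f).edges

/-- The subgraph of `G` formed by the branch vertices and the subdivided edges. -/
def Subdivision.toSubgraph {M : Graph α β} {G : SimpleGraph V} (D : Subdivision M G) :
    G.Subgraph :=
  (⨆ x, G.singletonSubgraph (D.branch x)) ⊔ ⨆ e, (D.route e).toSubgraph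

/-- The subgraph `Q` of `G` is an `M`-subdivision. -/
def IsSubdivision (M : Graph α β) {G : SimpleGraph V} (Q : G.Subgraph) : Prop :=
  ∃ D : Subdivision M G, D.toSubgraph = Q

/-- The family `𝓛(M, G)` of maximum `M`-subdivisions in `G`: those with the largest number of
edges among all `M`-subdivisions in `G`. -/
def maxSubdivisions (M : Graph α β) (G : SimpleGraph V) : Set G.Subgraph :=
  {Q | IsSubdivision M Q ∧
    ∀ R : G.Subgraph, IsSubdivision M R → R.edgeSet.ncard ≤ Q.edgeSet.ncard}

/-- Any two members of a family of subgraphs have a common vertex. -/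
def PairwiseIntersecting {G : SimpleGraph V} (L : Set G.Subgraph) : Prop :=
  ∀ Q ∈ L, ∀ R ∈ L, (Q.verts ∩ R.verts).Nonempty

/-- A transversal of a family of subgraphs: a vertex set that meets every member. -/
def IsTransversal {G : SimpleGraph V} (L : Set G.Subgraph) (S : Finset V) : Prop :=
  ∀ Q ∈ L, ∃ v ∈ S, v ∈ Q.verts

/-- `τ(M, G)`: the least size of a transversal of `𝓛(M, G)`. For finite `G` and for `M` with at
least one vertex, the set of all vertices of `G` is a transversal, so the minimum exists. -/
noncomputable def tau (M : Graph α β) (G : SimpleGraph V) : ℕ :=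
  sInf {k | ∃ S : Finset V, IsTransversal (maxSubdivisions M G) S ∧ S.card = k}

end MSub

/-! The maximum subdivisions, and likewise the longest paths of a connected graph, have connected
vertex sets that meet pairwise: they form a bramble. Write n for the order of `G` and m for the
number of edges of `M`, and suppose that no set within the claimed bound meets every member. Take s
just above √n, h about 3s/2 and z = h + m.

The rank of a set Z is the least size of an X separating Z from every member that avoids X. Rank is
subadditive and at most 1 on single vertices. On members it is large, because a set blocking a
member is a transversal. A member is a union of m paths, so it contains a path of rank at least s +
z, and hence one of rank exactly s + z. Let A be such a path, X a least blocking set of A, and D a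
second such path inside a member avoiding X. Fewer than s + z vertices cannot separate A from D
(`IsBramble.not_separates`), so `menger` gives s + z disjoint links. As n < s², more than z of them
have at most s vertices. Two of these, with a stretch of A through all their sources and a stretch
of D, close up to a cycle C of length at least z + 2. Some member R avoids X, a least blocking set
of D and the two links, hence also C. Minimality of X still gives z disjoint paths from C to R
(`IsBramble.card_le_of_separates`).

Two of these paths and an arc of C of at least half its length form a detour outside R. By
maximality of R, their ends are far apart whenever they lie on one route: at least g, about z/2. The
routes have total length at most n + m, so zg ≤ n + m + mg, that is hg ≤ n + m, which the choice of
h contradicts. -/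

namespace MSub

open SimpleGraph

/-! ### Menger's theorem, by induction on the number of edges. -/

section Menger

variable {V : Type*} {G H : SimpleGraph V} {A B : Set V}

/-- Every walk from `A` to `B` meets `S`. -/
def Separates (G : SimpleGraph V) (A B S : Set V) : Prop :=
  ∀ a ∈ A, ∀ b ∈ B, ∀ p : G.Walk a b, ∃ v ∈ p.support, v ∈ S

lemma Separates.symm {S : Set V} (h : Separates G A B S) : Separates G B A S := by
  intro b hb a ha p
  obtain ⟨v, hv, hS⟩ := h a ha b hb p.reverse
  exact ⟨v, by simpa using hv, hS⟩

/-- A walk from `A` to `B` contains a path from `A` to `B` meeting `A` and `B` only in its ends. -/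
lemma exists_trimmed_path {a b : V} (p : G.Walk a b) (ha : a ∈ A) (hb : b ∈ B) :
    ∃ a' b' : V, ∃ q : G.Walk a' b', a' ∈ A ∧ b' ∈ B ∧ q.IsPath ∧ q.support ⊆ p.support ∧
      (∀ v ∈ q.support, v ∈ A → v = a') ∧ (∀ v ∈ q.support, v ∈ B → v = b') := by
  classical
  induction hn : p.length using Nat.strong_induction_on generalizing a b with
  | _ n ih =>
  by_cases h1 : ∃ v ∈ p.support, v ∈ A ∧ v ≠ a
  · obtain ⟨v, hv, hvA, hva⟩ := h1
    obtain ⟨a', b', q, h⟩ := ih _ (hn ▸ p.length_dropUntil_lt_length hv hva) (p.dropUntil v hv)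
      hvA hb rfl
    exact ⟨a', b', q, h.1, h.2.1, h.2.2.1,
      fun _ hx => p.support_dropUntil_subset_support hv (h.2.2.2.1 hx), h.2.2.2.2⟩
  by_cases h2 : ∃ v ∈ p.support, v ∈ B ∧ v ≠ b
  · obtain ⟨v, hv, hvB, hvb⟩ := h2
    obtain ⟨a', b', q, h⟩ := ih _ (hn ▸ p.length_takeUntil_lt_length hv hvb) (p.takeUntil v hv)
      ha hvB rfl
    exact ⟨a', b', q, h.1, h.2.1, h.2.2.1,
      fun _ hx => p.support_takeUntil_subset_support hv (h.2.2.2.1 hx), h.2.2.2.2⟩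
  push Not at h1 h2
  have hsub := p.support_bypass_subset_support
  exact ⟨a, b, p.bypass, ha, hb, p.bypass_isPath, hsub, fun v hv => h1 v (hsub hv),
    fun v hv => h2 v (hsub hv)⟩

/-- A family of disjoint paths from `A` to `B` that meet `A` and `B` only in their ends. -/
structure Linkage (G : SimpleGraph V) (A B : Set V) (ι : Type*) where
  /-- The ends in `A`. -/
  src : ι → V
  /-- The ends in `B`. -/
  tgt : ι → V
  /-- The paths. -/
  walk : ∀ i, G.Walk (src i) (tgt i)
  src_mem : ∀ i, src i ∈ A
  tgt_mem : ∀ i, tgt i ∈ B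
  isPath : ∀ i, (walk i).IsPath
  eq_src : ∀ i, ∀ v ∈ (walk i).support, v ∈ A → v = src i
  eq_tgt : ∀ i, ∀ v ∈ (walk i).support, v ∈ B → v = tgt i
  disj : ∀ i j v, v ∈ (walk i).support → v ∈ (walk j).support → i = j

lemma Linkage.src_injective {ι : Type*} (L : Linkage G A B ι) : Function.Injective L.src := by
  intro i j h
  exact L.disj i j (L.src i) (Walk.start_mem_support _) (by rw [h]; exact Walk.start_mem_support _)

lemma Linkage.tgt_injective {ι : Type*} (L : Linkage G A B ι) : Function.Injective L.tgt := by
  intro i j h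
  exact L.disj i j (L.tgt i) (Walk.end_mem_support _) (by rw [h]; exact Walk.end_mem_support _)

lemma nonempty_linkage {ι : Type*} (a b : ι → V) (p : ∀ i, G.Walk (a i) (b i))
    (ha : ∀ i, a i ∈ A) (hb : ∀ i, b i ∈ B)
    (hd : ∀ i j v, v ∈ (p i).support → v ∈ (p j).support → i = j) :
    Nonempty (Linkage G A B ι) := by
  choose a' b' q h1 h2 h3 h4 h5 h6 using fun i => exists_trimmed_path (p i) (ha i) (hb i)
  exact ⟨⟨a', b', q, h1, h2, h3, h5, h6, fun i j v hi hj => hd i j v (h4 i hi) (h4 j hj)⟩⟩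

lemma Linkage.mono_graph {ι : Type*} (h : G ≤ H) (L : Linkage G A B ι) :
    Nonempty (Linkage H A B ι) :=
  nonempty_linkage L.src L.tgt (fun i => (L.walk i).mapLe h) L.src_mem L.tgt_mem
    (fun i j v hi hj => L.disj i j v (by simpa using hi) (by simpa using hj))

lemma deleteEdges_adj_of_notMem {x y u v : V} (h : G.Adj u v) (hne : s(u, v) ≠ s(x, y)) :
    (G.deleteEdges {s(x, y)}).Adj u v := by
  simp [SimpleGraph.deleteEdges_adj, h, hne]

/-- Without `S` and the edge `xy`, `y` cannot be reached from `A`. So a walk of `G` from `A` to `B`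
must meet `S` or `x`, and a path inside it from `A` to its first vertex in `insert x S` cannot use
`xy`: it would reach `y` before `x`. That path survives the deletion and meets `T`. -/
lemma separates_of_separates_deleteEdges {S : Set V} {x y : V} {T : Set V} (hxy : x ≠ y)
    (hx : ∃ a ∈ A, ∃ p : (G.deleteEdges {s(x, y)}).Walk a x, ∀ v ∈ p.support, v ∉ S)
    (hy : ∃ b ∈ B, ∃ p : (G.deleteEdges {s(x, y)}).Walk b y, ∀ v ∈ p.support, v ∉ S)
    (hS : Separates (G.deleteEdges {s(x, y)}) A B S)
    (hT : Separates (G.deleteEdges {s(x, y)}) A (insert x S) T) : Separates G A B T := by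
  classical
  set G' := G.deleteEdges {s(x, y)} with hG'
  let RA : Set V := {w | ∃ a ∈ A, ∃ p : G'.Walk a w, ∀ v ∈ p.support, v ∉ S}
  have hyRA : y ∉ RA := by
    rintro ⟨a, ha, p, hp⟩
    obtain ⟨b, hb, q, hq⟩ := hy
    obtain ⟨v, hv, hvS⟩ := hS a ha b hb (p.append q.reverse)
    rw [Walk.mem_support_append_iff] at hv
    rcases hv with hv | hv
    · exact hp v hv hvS
    · exact hq v (by simpa using hv) hvS
  intro a ha b hb p
  have hmeet : ∃ v ∈ p.support, v ∈ insert x S := by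
    by_contra! hcon
    have hbRA : b ∉ RA := by
      rintro ⟨a', ha', q, hq⟩
      obtain ⟨v, hv, hvS⟩ := hS a' ha' b hb q
      exact hq v hv hvS
    have haRA : a ∈ RA := ⟨a, ha, .nil, by
      intro v hv; simp at hv; subst hv
      exact fun h => hcon v p.start_mem_support (Or.inr h)⟩
    obtain ⟨d, hd, h1, h2⟩ := p.exists_boundary_dart RA haRA hbRA
    have hd1 := p.dart_fst_mem_support_of_mem_darts hd
    have hd2 := p.dart_snd_mem_support_of_mem_darts hd
    by_cases he : s(d.fst, d.snd) = s(x, y)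
    · rw [Sym2.eq_iff] at he
      rcases he with ⟨h, -⟩ | ⟨h, -⟩
      · exact hcon _ hd1 (Or.inl h)
      · exact hyRA (h ▸ h1)
    · obtain ⟨a', ha', q, hq⟩ := h1
      refine h2 ⟨a', ha', q.concat (deleteEdges_adj_of_notMem d.adj he), ?_⟩
      intro v hv
      rw [Walk.support_concat, List.mem_append, List.mem_singleton] at hv
      rcases hv with hv | rfl
      · exact hq v hv
      · exact fun h => hcon _ hd2 (Or.inr h)
  obtain ⟨c, hc, hcS⟩ := hmeet
  obtain ⟨a', s, q, ha', hs, hq, hqs, -, hqS⟩ := exists_trimmed_path (p.takeUntil c hc) ha hcS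
  have hedge : ∀ e ∈ q.edges, e ∈ G'.edgeSet := by
    intro e he
    rw [hG', SimpleGraph.edgeSet_deleteEdges]
    refine ⟨q.edges_subset_edgeSet he, ?_⟩
    rintro rfl
    have hxq : x ∈ q.support := q.fst_mem_support_of_mem_edges he
    have hyq : y ∈ q.support := q.snd_mem_support_of_mem_edges he
    obtain rfl := hqS x hxq (Or.inl rfl)
    have hnx : x ∉ (q.takeUntil y hyq).support :=
      Walk.endpoint_notMem_support_takeUntil hq hyq hxy
    have htr : ∀ e ∈ (q.takeUntil y hyq).edges, e ∈ G'.edgeSet := by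
      intro e he'
      rw [hG', SimpleGraph.edgeSet_deleteEdges]
      refine ⟨Walk.edges_subset_edgeSet _ he', ?_⟩
      rintro rfl
      exact hnx (Walk.fst_mem_support_of_mem_edges _ he')
    refine hyRA ⟨a', ha', (q.takeUntil y hyq).transfer G' htr, ?_⟩
    intro v hv hvS
    rw [Walk.support_transfer] at hv
    have := hqS v (q.support_takeUntil_subset_support hyq hv) (Or.inr hvS)
    exact hnx (this ▸ hv)
  obtain ⟨v, hv, hvT⟩ := hT a' ha' s hs (q.transfer G' hedge)
  rw [Walk.support_transfer] at hv
  exact ⟨v, p.support_takeUntil_subset_support hc (hqs hv), hvT⟩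

/-- Menger's theorem. -/
theorem menger [Finite V] (k : ℕ) (G : SimpleGraph V) (A B : Set V)
    (h : ∀ S : Finset V, Separates G A B S → k ≤ S.card) :
    Nonempty (Linkage G A B (Fin k)) := by
  classical
  cases nonempty_fintype V
  induction hn : G.edgeSet.ncard using Nat.strong_induction_on generalizing G A B with
  | _ n ih =>
  by_cases hE : G.edgeSet = ∅
  · have hk := h (A ∩ B).toFinset (by
      intro a ha b hb p
      cases p with
      | nil => exact ⟨a, by simp, by simp [ha, hb]⟩
      | cons hadj _ =>
        have := (SimpleGraph.mem_edgeSet G).2 hadj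
        simp [hE] at this)
    obtain ⟨f⟩ : Nonempty (Fin k ↪ (A ∩ B).toFinset) :=
      Function.Embedding.nonempty_of_card_le (by rw [Fintype.card_fin, Fintype.card_coe]; exact hk)
    have hf : ∀ i, (f i : V) ∈ A ∩ B := fun i => by simpa using (f i).2
    refine nonempty_linkage (fun i => (f i : V)) (fun i => (f i : V)) (fun i => .nil)
      (fun i => (hf i).1) (fun i => (hf i).2) ?_
    intro i j v hi hj
    simp at hi hj
    exact f.injective (Subtype.ext (hi.symm.trans hj))
  obtain ⟨e, he⟩ := Set.nonempty_iff_ne_empty.2 hE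
  have hlt : (G.deleteEdges {e}).edgeSet.ncard < n := by
    rw [← hn, SimpleGraph.edgeSet_deleteEdges]
    exact Set.ncard_sdiff_singleton_lt_of_mem he
  by_cases hk : ∀ S : Finset V, Separates (G.deleteEdges {e}) A B S → k ≤ S.card
  · obtain ⟨L⟩ := ih _ hlt _ A B hk rfl
    exact L.mono_graph (SimpleGraph.deleteEdges_le _)
  push Not at hk
  obtain ⟨S, hS, hSk⟩ := hk
  have hnot : ¬ Separates G A B S := fun hc => absurd (h S hc) (by omega)
  unfold Separates at hnot
  push Not at hnot
  obtain ⟨a, ha, b, hb, p, hp⟩ := hnot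
  let RA : Set V := {w | ∃ a ∈ A, ∃ p : (G.deleteEdges {e}).Walk a w, ∀ v ∈ p.support, v ∉ S}
  let RB : Set V := {w | ∃ b ∈ B, ∃ p : (G.deleteEdges {e}).Walk b w, ∀ v ∈ p.support, v ∉ S}
  have hdisj : ∀ w ∈ RA, w ∉ RB := by
    rintro w ⟨a, ha, p, hp⟩ ⟨b, hb, q, hq⟩
    obtain ⟨v, hv, hvS⟩ := hS a ha b hb (p.append q.reverse)
    rw [Walk.mem_support_append_iff] at hv
    rcases hv with hv | hv
    · exact hp v hv hvS
    · exact hq v (by simpa using hv) hvS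
  have haRA : a ∈ RA := ⟨a, ha, .nil, by
    intro v hv; simp at hv; subst hv; exact hp v p.start_mem_support⟩
  have hbRB : b ∈ RB := ⟨b, hb, .nil, by
    intro v hv; simp at hv; subst hv; exact hp v p.end_mem_support⟩
  have cross : ∀ (C : Set V) (u w : V), G.Adj u w → w ∉ S →
      (∃ a ∈ C, ∃ p : (G.deleteEdges {e}).Walk a u, ∀ v ∈ p.support, v ∉ S) →
      (¬ ∃ a ∈ C, ∃ p : (G.deleteEdges {e}).Walk a w, ∀ v ∈ p.support, v ∉ S) → s(u, w) = e := by
    rintro C u w hadj hw ⟨a', ha', q, hq⟩ hnot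
    by_contra hne
    refine hnot ⟨a', ha', q.concat
      (by simp [SimpleGraph.deleteEdges_adj, hadj, hne]), ?_⟩
    intro v hv
    rw [Walk.support_concat, List.mem_append, List.mem_singleton] at hv
    rcases hv with hv | rfl
    · exact hq v hv
    · exact hw
  -- The walk `p` avoids `S`, so it can leave `RA`, and enter `RB`, only by the deleted edge; this
  -- places one end of that edge in each.
  obtain ⟨d, hd, h1, h2⟩ := p.exists_boundary_dart RA haRA (fun hc => hdisj b hc hbRB)
  obtain ⟨d', hd', h1', h2'⟩ := p.exists_boundary_dart RBᶜ (hdisj a haRA) (by simpa using hbRB)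
  have hde := cross A _ _ d.adj (hp _ (p.dart_snd_mem_support_of_mem_darts hd)) h1 h2
  have hde' := cross B _ _ d'.adj.symm (hp _ (p.dart_fst_mem_support_of_mem_darts hd'))
    (not_not.1 h2') h1'
  obtain ⟨⟨x, y⟩, hadj⟩ := d
  have hyRB : y ∈ RB := by
    rw [← hde'] at hde
    simp only [Sym2.eq_iff] at hde
    rcases hde with ⟨h3, h4⟩ | ⟨h3, h4⟩
    · exact absurd (not_not.1 h2') (h3 ▸ hdisj _ h1)
    · exact h4 ▸ not_not.1 h2'
  simp only at h1 h2 hde hadj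
  subst hde
  have hxy : x ≠ y := hadj.ne
  have hxS : x ∉ S := by
    obtain ⟨a', ha', q, hq⟩ := h1
    exact hq x q.end_mem_support
  have hyS : y ∉ S := by
    obtain ⟨a', ha', q, hq⟩ := hyRB
    exact hq y q.end_mem_support
  have hcardx : (insert x S).card = S.card + 1 := Finset.card_insert_of_notMem hxS
  have hcardy : (insert y S).card = S.card + 1 := Finset.card_insert_of_notMem hyS
  have sepx : ∀ T : Finset V, Separates (G.deleteEdges {s(x, y)}) A (insert x S : Finset V) T →
      k ≤ T.card := by
    intro T hT
    rw [Finset.coe_insert] at hT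
    exact h T (separates_of_separates_deleteEdges hxy h1 hyRB hS hT)
  have sepy : ∀ T : Finset V, Separates (G.deleteEdges {s(x, y)}) B (insert y S : Finset V) T →
      k ≤ T.card := by
    intro T hT
    rw [Finset.coe_insert] at hT
    have hswap : s(x, y) = s(y, x) := Sym2.eq_swap
    refine h T (Separates.symm ?_)
    refine separates_of_separates_deleteEdges (x := y) (y := x) (S := S) hxy.symm ?_ ?_ ?_ ?_
    · rw [← hswap]; exact hyRB
    · rw [← hswap]; exact h1
    · rw [← hswap]; exact hS.symm
    · rw [← hswap]; exact hT
  obtain ⟨L1⟩ := ih _ hlt _ A (insert x S : Finset V) sepx rfl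
  obtain ⟨L2⟩ := ih _ hlt _ B (insert y S : Finset V) sepy rfl
  have hkS : k = S.card + 1 := by
    refine le_antisymm ?_ hSk
    rw [← hcardx]
    refine sepx _ ?_
    intro a' _ b' hb' q
    exact ⟨b', q.end_mem_support, hb'⟩
  have himg : Finset.univ.image L2.tgt = insert y S := by
    refine Finset.eq_of_subset_of_card_le ?_ ?_
    · intro v hv
      simp only [Finset.mem_image, Finset.mem_univ, true_and] at hv
      obtain ⟨i, rfl⟩ := hv
      exact_mod_cast L2.tgt_mem i
    · rw [Finset.card_image_of_injective _ L2.tgt_injective, hcardy]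
      simp [hkS]
  -- The targets of `L2` exhaust `insert y S`. A path of `L1` ending in `S` continues from the same
  -- vertex; one ending in `x` crosses `xy`.
  have hconn : ∀ i : Fin k, ∃ j : Fin k, ∃ q : G.Walk (L1.tgt i) (L2.tgt j),
      (∀ v ∈ q.support, v = L1.tgt i ∨ v = L2.tgt j) ∧
      (L1.tgt i ∈ S → L2.tgt j = L1.tgt i) ∧ (L1.tgt i ∉ S → L1.tgt i = x ∧ L2.tgt j = y) := by
    intro i
    have hm : L1.tgt i ∈ insert x S := by exact_mod_cast L1.tgt_mem i
    by_cases hi : L1.tgt i ∈ S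
    · have : L1.tgt i ∈ Finset.univ.image L2.tgt := by
        rw [himg]; exact Finset.mem_insert_of_mem hi
      simp only [Finset.mem_image, Finset.mem_univ, true_and] at this
      obtain ⟨j, hj⟩ := this
      exact ⟨j, Walk.nil.copy rfl hj.symm, by simp, fun _ => hj, fun h => absurd hi h⟩
    · have hix : L1.tgt i = x := (Finset.mem_insert.1 hm).resolve_right hi
      have : y ∈ Finset.univ.image L2.tgt := by
        rw [himg]; exact Finset.mem_insert_self _ _
      simp only [Finset.mem_image, Finset.mem_univ, true_and] at this
      obtain ⟨j, hj⟩ := this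
      exact ⟨j, (Walk.cons hadj Walk.nil).copy hix.symm hj.symm, by simp [hix, hj],
        fun h => absurd h hi, fun _ => ⟨hix, hj⟩⟩
  choose σ q hq hσS hσx using hconn
  have hmix : ∀ i j v, v ∈ (L1.walk i).support → v ∈ (L2.walk j).support →
      v ∈ S ∧ v = L1.tgt i ∧ v = L2.tgt j := by
    intro i j v hi hj
    have hvS : v ∈ S := by
      obtain ⟨u, hu, huS⟩ := hS _ (L1.src_mem i) _ (L2.src_mem j)
        (((L1.walk i).takeUntil v hi).append ((L2.walk j).takeUntil v hj).reverse)
      rw [Walk.mem_support_append_iff, Walk.support_reverse, List.mem_reverse] at hu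
      rcases hu with hu | hu
      · have h3 := L1.eq_tgt i u (Walk.support_takeUntil_subset_support _ hi hu)
          (by simpa using Or.inr huS)
        by_cases hv : L1.tgt i = v
        · rw [← hv, ← h3]; exact huS
        · exact absurd (h3 ▸ hu) (Walk.endpoint_notMem_support_takeUntil (L1.isPath i) hi hv)
      · have h3 := L2.eq_tgt j u (Walk.support_takeUntil_subset_support _ hj hu)
          (by simpa using Or.inr huS)
        by_cases hv : L2.tgt j = v
        · rw [← hv, ← h3]; exact huS
        · exact absurd (h3 ▸ hu) (Walk.endpoint_notMem_support_takeUntil (L2.isPath j) hj hv)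
    exact ⟨hvS, L1.eq_tgt i v hi (by simpa using Or.inr hvS),
      L2.eq_tgt j v hj (by simpa using Or.inr hvS)⟩
  have hσinj : Function.Injective σ := by
    intro i j hij
    apply L1.tgt_injective
    by_cases hi : L1.tgt i ∈ S <;> by_cases hj : L1.tgt j ∈ S
    · rw [← hσS i hi, ← hσS j hj, hij]
    · exact absurd (hσS i hi ▸ hi) (by rw [hij, (hσx j hj).2]; exact hyS)
    · exact absurd (hσS j hj ▸ hj) (by rw [← hij, (hσx i hi).2]; exact hyS)
    · rw [(hσx i hi).1, (hσx j hj).1]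
  have hmix' : ∀ i i' v, v ∈ (L1.walk i).support → v ∈ (L2.walk (σ i')).support → i = i' := by
    intro i i' v hi hj
    obtain ⟨hvS, h3, h4⟩ := hmix i (σ i') v hi hj
    apply hσinj
    apply L2.tgt_injective
    rw [← h4, h3]
    exact hσS i (h3 ▸ hvS)
  have hle : G.deleteEdges {s(x, y)} ≤ G := SimpleGraph.deleteEdges_le _
  have hsupp : ∀ i v, v ∈ ((((L1.walk i).mapLe hle).append (q i)).append
      ((L2.walk (σ i)).mapLe hle).reverse).support →
      v ∈ (L1.walk i).support ∨ v ∈ (L2.walk (σ i)).support := by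
    intro i v hv
    simp only [Walk.mem_support_append_iff, Walk.support_reverse, List.mem_reverse,
      Walk.support_mapLe_eq_support] at hv
    rcases hv with (hv | hv) | hv
    · exact Or.inl hv
    · rcases hq i v hv with rfl | rfl
      · exact Or.inl (Walk.end_mem_support _)
      · exact Or.inr (Walk.end_mem_support _)
    · exact Or.inr hv
  refine nonempty_linkage L1.src (fun i => L2.src (σ i))
    (fun i => (((L1.walk i).mapLe hle).append (q i)).append ((L2.walk (σ i)).mapLe hle).reverse)
    L1.src_mem (fun i => L2.src_mem _) ?_
  intro i j v hi hj
  rcases hsupp i v hi with hi | hi <;> rcases hsupp j v hj with hj | hj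
  · exact L1.disj i j v hi hj
  · exact hmix' i j v hi hj
  · exact (hmix' j i v hj hi).symm
  · exact hσinj (L2.disj _ _ v hi hj)

end Menger

/-! ### Blocking sets, rank and brambles. -/

section Rank

variable {V : Type*} {G : SimpleGraph V} {F : Set (Set V)}

/-- `X` separates `Z` from every member of the family `F` that avoids `X`. -/
def Blocks (G : SimpleGraph V) (F : Set (Set V)) (X Z : Set V) : Prop :=
  ∀ Q ∈ F, Disjoint Q X → Separates G Z Q X

lemma blocks_self (Z : Set V) : Blocks G F Z Z :=
  fun _ _ _ a ha _ _ p => ⟨a, p.start_mem_support, ha⟩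

lemma Blocks.union {X Y Z W : Set V} (h1 : Blocks G F X Z) (h2 : Blocks G F Y W) :
    Blocks G F (X ∪ Y) (Z ∪ W) := by
  intro Q hQ hd a ha b hb p
  rw [Set.disjoint_union_right] at hd
  rcases ha with ha | ha
  · obtain ⟨v, hv, hx⟩ := h1 Q hQ hd.1 a ha b hb p
    exact ⟨v, hv, Or.inl hx⟩
  · obtain ⟨v, hv, hx⟩ := h2 Q hQ hd.2 a ha b hb p
    exact ⟨v, hv, Or.inr hx⟩

lemma Blocks.disjoint {X Z Q : Set V} (h : Blocks G F X Z) (hQ : Q ∈ F) (hd : Disjoint Q X) :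
    Disjoint Z Q := by
  rw [Set.disjoint_left]
  intro a ha haQ
  obtain ⟨v, hv, hx⟩ := h Q hQ hd a ha a haQ .nil
  simp only [Walk.support_nil, List.mem_singleton] at hv
  subst hv
  exact Set.disjoint_left.1 hd haQ hx

/-- The least size of a set blocking `Z`. -/
noncomputable def rank (G : SimpleGraph V) (F : Set (Set V)) (Z : Set V) : ℕ :=
  sInf {k | ∃ X : Finset V, Blocks G F X Z ∧ X.card = k}

lemma rank_le {X : Finset V} {Z : Set V} (h : Blocks G F X Z) : rank G F Z ≤ X.card :=
  Nat.sInf_le ⟨X, h, rfl⟩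

lemma exists_blocks_card_eq [Finite V] (Z : Set V) :
    ∃ X : Finset V, Blocks G F X Z ∧ X.card = rank G F Z := by
  have : {k | ∃ X : Finset V, Blocks G F X Z ∧ X.card = k}.Nonempty :=
    ⟨_, (Set.toFinite Z).toFinset, by simpa using blocks_self Z, rfl⟩
  exact Nat.sInf_mem this

lemma rank_empty : rank G F ∅ = 0 :=
  Nat.le_zero.1 (rank_le (X := ∅) (by simpa using blocks_self (G := G) (F := F) ∅))

lemma rank_union_le [Finite V] (Z W : Set V) :
    rank G F (Z ∪ W) ≤ rank G F Z + rank G F W := by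
  classical
  obtain ⟨X, hX, hc⟩ := exists_blocks_card_eq (G := G) (F := F) Z
  obtain ⟨Y, hY, hd⟩ := exists_blocks_card_eq (G := G) (F := F) W
  have h : Blocks G F (X ∪ Y : Finset V) (Z ∪ W) := by
    rw [Finset.coe_union]; exact hX.union hY
  exact (rank_le h).trans (hc ▸ hd ▸ Finset.card_union_le _ _)

lemma rank_singleton_le (v : V) : rank G F {v} ≤ 1 :=
  rank_le (X := {v}) (by simpa using blocks_self (G := G) (F := F) {v})

lemma rank_iUnion_le [Finite V] {E : Type*} [Fintype E] (Z : E → Set V) (b : ℕ)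
    (h : ∀ e, rank G F (Z e) ≤ b) : rank G F (⋃ e, Z e) ≤ Fintype.card E * b := by
  classical
  have key : ∀ s : Finset E, rank G F (⋃ e ∈ s, Z e) ≤ s.card * b := by
    intro s
    induction s using Finset.induction_on with
    | empty => simp [rank_empty]
    | insert a s ha ih =>
      rw [Finset.set_biUnion_insert, Finset.card_insert_of_notMem ha]
      calc _ ≤ _ := rank_union_le _ _
        _ ≤ b + s.card * b := Nat.add_le_add (h a) ih
        _ = _ := by ring
  simpa using key Finset.univ

/-- A path of rank at least `y` has a subpath of rank exactly `y`. -/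
lemma exists_subpath_rank_eq [Finite V] {y : ℕ} (hy : 0 < y) {u v : V} (p : G.Walk u v)
    (hp : p.IsPath) (h : y ≤ rank G F {x | x ∈ p.support}) :
    ∃ a b : V, ∃ q : G.Walk a b, q.IsPath ∧ q.support ⊆ p.support ∧
      rank G F {x | x ∈ q.support} = y := by
  induction p with
  | nil =>
    refine ⟨_, _, .nil, hp, fun _ hx => hx, le_antisymm ?_ h⟩
    have := rank_singleton_le (G := G) (F := F)
    simp only [Walk.support_nil, List.mem_singleton]
    exact (this _).trans hy
  | @cons u w v hadj p ih =>
    by_cases h' : y ≤ rank G F {x | x ∈ p.support}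
    · obtain ⟨a, b, q, h1, h2, h3⟩ := ih hp.of_cons h'
      exact ⟨a, b, q, h1, fun x hx => by simp [h2 hx], h3⟩
    -- Dropping the first vertex lowers the rank by at most one, and here it falls below `y`.
    · refine ⟨_, _, _, hp, fun _ hx => hx, le_antisymm ?_ h⟩
      have hset : {x | x ∈ (Walk.cons hadj p).support} = {u} ∪ {x | x ∈ p.support} := by
        ext x; simp
      rw [hset]
      have h1 := rank_union_le (G := G) (F := F) {u} {x | x ∈ p.support}
      have h2 := rank_singleton_le (G := G) (F := F) u
      omega

lemma exists_not_separates {S : Finset V} {Z : Set V} (h : S.card < rank G F Z) :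
    ∃ Q ∈ F, Disjoint Q (S : Set V) ∧ ¬ Separates G Z Q S := by
  by_contra! hcon
  exact absurd (rank_le (X := S) hcon) (by omega)

/-- The members of `F` are connected and pairwise intersecting. -/
structure IsBramble (G : SimpleGraph V) (F : Set (Set V)) : Prop where
  connected : ∀ Q ∈ F, ∀ u ∈ Q, ∀ v ∈ Q, ∃ p : G.Walk u v, ∀ x ∈ p.support, x ∈ Q
  intersecting : ∀ Q ∈ F, ∀ R ∈ F, (Q ∩ R).Nonempty

/-- A set this small blocks neither `A` nor `D`: each reaches, off `S`, a member avoiding `S`, and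
these two members are connected and share a vertex. -/
lemma IsBramble.not_separates (hF : IsBramble G F) {S : Finset V} {A D : Set V}
    (hA : S.card < rank G F A) (hD : S.card < rank G F D) : ¬ Separates G A D S := by
  obtain ⟨Q, hQ, hQS, h1⟩ := exists_not_separates hA
  obtain ⟨R, hR, hRS, h2⟩ := exists_not_separates hD
  obtain ⟨w, hwQ, hwR⟩ := hF.intersecting Q hQ R hR
  unfold Separates at h1 h2 ⊢
  push Not at h1 h2 ⊢
  obtain ⟨a, ha, q, hq, p, hp⟩ := h1
  obtain ⟨d, hd, r, hr, p', hp'⟩ := h2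
  obtain ⟨q1, hq1⟩ := hF.connected Q hQ q hq w hwQ
  obtain ⟨r1, hr1⟩ := hF.connected R hR w hwR r hr
  refine ⟨a, ha, d, hd, ((p.append q1).append r1).append p'.reverse, ?_⟩
  intro v hv
  simp only [Walk.mem_support_append_iff, Walk.support_reverse, List.mem_reverse] at hv
  rcases hv with ((hv | hv) | hv) | hv
  · exact hp v hv
  · exact Set.disjoint_left.1 hQS (hq1 v hv)
  · exact Set.disjoint_left.1 hRS (hr1 v hv)
  · exact hp' v hv

/-- A member has rank at least every lower bound for the sizes of transversals. -/
lemma IsBramble.le_rank [Finite V] (hF : IsBramble G F) {T : ℕ}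
    (hT : ∀ S : Finset V, S.card ≤ T → ∃ Q ∈ F, Disjoint Q (S : Set V)) {P : Set V} (hP : P ∈ F) :
    T < rank G F P := by
  by_contra! hcon
  obtain ⟨X, hX, hc⟩ := exists_blocks_card_eq (G := G) (F := F) P
  obtain ⟨Q, hQ, hd⟩ := hT X (by omega)
  obtain ⟨w, h1, h2⟩ := hF.intersecting P hP Q hQ
  exact Set.disjoint_left.1 (hX.disjoint hQ hd) h1 h2

/-- If `A` is linked to a member avoiding a least blocking set of `A`, then the ends of
the linkage in `A` are linked to every other such member. -/
lemma IsBramble.card_le_of_separates (hF : IsBramble G F) {ι : Type*} [Fintype ι]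
    {A D Q R O : Set V} {X : Finset V} (hX : Blocks G F X A) (hXc : X.card = Fintype.card ι)
    (hA : Fintype.card ι ≤ rank G F A) (L : Linkage G A D ι) (hQ : Q ∈ F)
    (hQX : Disjoint Q (X : Set V)) (hDQ : D ⊆ Q) (hR : R ∈ F) (hRX : Disjoint R (X : Set V))
    (K : Finset ι) (hK : ∀ k ∈ K, L.src k ∈ O) (S : Finset V) (hS : Separates G O R S) :
    K.card ≤ S.card := by
  classical
  by_contra! hlt
  have hx : ∀ k, ∃ v ∈ (L.walk k).support, v ∈ X := fun k => by
    simpa using hX Q hQ hQX _ (L.src_mem k) _ (hDQ (L.tgt_mem k)) (L.walk k)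
  choose x hxW hxX using hx
  have hxinj : Function.Injective x := fun i j hij => L.disj i j (x i) (hxW i) (hij ▸ hxW j)
  -- There are as many disjoint links as elements of `X`, and each link meets `X`; so each crosses
  -- `X` exactly once.
  have himg : Finset.univ.image x = X := by
    refine Finset.eq_of_subset_of_card_le ?_ ?_
    · intro v hv
      simp only [Finset.mem_image, Finset.mem_univ, true_and] at hv
      obtain ⟨i, rfl⟩ := hv
      exact hxX i
    · rw [Finset.card_image_of_injective _ hxinj, hXc, Finset.card_univ]
  have hsurj : ∀ v ∈ X, ∃ k, x k = v := by
    intro v hv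
    rw [← himg] at hv
    simpa using hv
  have huniq : ∀ k v, v ∈ (L.walk k).support → v ∈ X → v = x k := by
    intro k v hv hvX
    obtain ⟨l, rfl⟩ := hsurj v hvX
    rw [L.disj k l _ hv (hxW l)]
  let W : ∀ k, G.Walk (L.src k) (x k) := fun k => (L.walk k).takeUntil (x k) (hxW k)
  have hWsub : ∀ k, (W k).support ⊆ (L.walk k).support := fun k =>
    Walk.support_takeUntil_subset_support _ _
  have hWpath : ∀ k, (W k).IsPath := fun k => (L.isPath k).takeUntil _
  -- Vertices of `S` on the initial segments are exchanged for the crossings `x k` of the segments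
  -- in `K` that they hit, and all crossings outside `K` are added. As `S` is smaller than `K`, the
  -- result `S'` has fewer than `rank G F A` elements and cannot block `A`.
  let bad := K.filter fun k => ∃ v ∈ (W k).support, v ∈ S
  let S' := (S.filter fun v => ¬ ∃ k, v ∈ (W k).support) ∪ bad.image x ∪ Kᶜ.image x
  have hbad : bad.card ≤ (S.filter fun v => ∃ k, v ∈ (W k).support).card := by
    have : ∀ k, ∃ v, k ∈ bad → v ∈ (W k).support ∧ v ∈ S := fun k => by
      by_cases hk : k ∈ bad
      · obtain ⟨v, hv⟩ := (Finset.mem_filter.1 hk).2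
        exact ⟨v, fun _ => hv⟩
      · exact ⟨x k, fun h => absurd h hk⟩
    choose f hf using this
    refine Finset.card_le_card_of_injOn f ?_ ?_
    · intro k hk
      simp only [Finset.coe_filter, Set.mem_ofPred_eq]
      exact ⟨(hf k hk).2, k, (hf k hk).1⟩
    · intro k hk l hl hkl
      exact L.disj k l (f k) (hWsub k (hf k hk).1) (hkl ▸ hWsub l (hf l hl).1)
  have hS'card : S'.card < Fintype.card ι := by
    have h1 := Finset.card_filter_add_card_filter_not (s := S) (fun v => ∃ k, v ∈ (W k).support)
    have h2 : S'.card ≤ (S.filter fun v => ¬ ∃ k, v ∈ (W k).support).card + bad.card + Kᶜ.card :=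
      (Finset.card_union_le _ _).trans (Nat.add_le_add ((Finset.card_union_le _ _).trans
        (Nat.add_le_add_left Finset.card_image_le _)) Finset.card_image_le)
    have h3 := Finset.card_add_card_compl K
    omega
  obtain ⟨Q1, hQ1, hQ1S, hnot⟩ := exists_not_separates (hS'card.trans_le hA)
  unfold Separates at hnot
  push Not at hnot
  obtain ⟨a, ha, q, hq, p, hp⟩ := hnot
  obtain ⟨r, hrQ, hrR⟩ := hF.intersecting Q1 hQ1 R hR
  obtain ⟨p', hp'⟩ := hF.connected Q1 hQ1 q hq r hrQ
  have hpp : ∀ v ∈ (p.append p').support, v ∉ S' := by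
    intro v hv
    rw [Walk.mem_support_append_iff] at hv
    rcases hv with hv | hv
    · exact_mod_cast hp v hv
    · exact_mod_cast Set.disjoint_left.1 hQ1S (hp' v hv)
  obtain ⟨u, hu, huX⟩ := hX R hR hRX a ha r hrR (p.append p')
  obtain ⟨u', r', p2, hu'X, hr'R, hp2path, hp2sub, hp2X, -⟩ :=
    exists_trimmed_path ((p.append p').dropUntil u hu) huX hrR
  have hp2S' : ∀ v ∈ p2.support, v ∉ S' := fun v hv =>
    hpp v (Walk.support_dropUntil_subset_support _ _ (hp2sub hv))
  obtain ⟨k, rfl⟩ := hsurj u' hu'X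
  have hkK : k ∈ K := by
    by_contra hk
    refine hp2S' _ p2.start_mem_support (Finset.mem_union_right _ ?_)
    exact Finset.mem_image_of_mem _ (by simpa using hk)
  have hkbad : ∀ v ∈ (W k).support, v ∉ S := by
    by_contra! hk
    refine hp2S' _ p2.start_mem_support (Finset.mem_union_left _ (Finset.mem_union_right _ ?_))
    exact Finset.mem_image_of_mem _ (Finset.mem_filter.2 ⟨hkK, hk⟩)
  -- A vertex of `S` on `p2` lies on some `W l`, being outside `S'`. Following `W l` to it and then
  -- `p2` to `R` must meet `X`, which forces the vertex to be `x k`; but `W k` avoids `S`.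
  have hp2S : ∀ v ∈ p2.support, v ∉ S := by
    intro v hv hvS
    have hl : ∃ l, v ∈ (W l).support := by
      by_contra hl
      exact hp2S' v hv (Finset.mem_union_left _ (Finset.mem_union_left _
        (Finset.mem_filter.2 ⟨hvS, hl⟩)))
    obtain ⟨l, hl⟩ := hl
    have hv' : v ∈ p2.reverse.support := by simpa using hv
    have hvk : v = x k := by
      obtain ⟨w, hw, hwX⟩ := hX R hR hRX _ (L.src_mem l) _ hr'R
        (((W l).takeUntil v hl).append (p2.reverse.takeUntil v hv').reverse)
      rw [Walk.mem_support_append_iff, Walk.support_reverse, List.mem_reverse] at hw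
      rcases hw with hw | hw
      · have h1 := huniq l w (hWsub l (Walk.support_takeUntil_subset_support _ _ hw)) hwX
        by_cases hvl : x l = v
        · exact hp2X v hv (hvl ▸ hxX l)
        · exact absurd (h1 ▸ hw) (Walk.endpoint_notMem_support_takeUntil (hWpath l) hl hvl)
      · have h1 := hp2X w (by simpa using Walk.support_takeUntil_subset_support _ _ hw) hwX
        by_cases hvk : x k = v
        · exact hvk.symm
        · exact absurd (h1 ▸ hw)
            (Walk.endpoint_notMem_support_takeUntil hp2path.reverse hv' hvk)
    exact hkbad v (by rw [hvk]; exact Walk.end_mem_support _) hvS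
  obtain ⟨v, hv, hvS⟩ := hS _ (hK k hkK) _ hr'R ((W k).append p2)
  rw [Walk.mem_support_append_iff] at hv
  rcases hv with hv | hv
  · exact hkbad v hv hvS
  · exact hp2S v hv hvS

end Rank

/-! ### A long cycle highly linked to a member disjoint from it. -/

section Cycle

variable {V : Type*} {G : SimpleGraph V} {F : Set (Set V)}

lemma isPath_append {u v w : V} {p : G.Walk u v} {q : G.Walk v w} (hp : p.IsPath) (hq : q.IsPath)
    (h : ∀ x ∈ p.support, x ∈ q.support → x = v) : (p.append q).IsPath := by
  rw [Walk.isPath_def, Walk.support_append, List.nodup_append']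
  have hq' := hq.support_nodup
  rw [← Walk.cons_tail_support, List.nodup_cons] at hq'
  refine ⟨hp.support_nodup, hq'.2, ?_⟩
  intro x hx hx'
  exact hq'.1 (h x hx (List.mem_of_mem_tail hx') ▸ hx')

lemma exists_subpath_start_mem {T : Set V} {u v : V} (p : G.Walk u v) (hp : p.IsPath)
    (hne : T.Nonempty) (hT : ∀ t ∈ T, t ∈ p.support) :
    ∃ a ∈ T, ∃ q : G.Walk a v, q.IsPath ∧ q.support ⊆ p.support ∧ ∀ t ∈ T, t ∈ q.support := by
  induction p with
  | @nil u =>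
    obtain ⟨t, ht⟩ := hne
    have := hT t ht
    simp only [Walk.support_nil, List.mem_singleton] at this
    subst this
    exact ⟨_, ht, .nil, hp, fun _ h => h, hT⟩
  | @cons u w v hadj p ih =>
    by_cases hu : u ∈ T
    · exact ⟨u, hu, _, hp, fun _ h => h, hT⟩
    · obtain ⟨a, ha, q, h1, h2, h3⟩ := ih hp.of_cons (fun t ht => by
        have := hT t ht
        simp only [Walk.support_cons, List.mem_cons] at this
        rcases this with rfl | this
        · exact absurd ht hu
        · exact this)
      exact ⟨a, ha, q, h1, fun x hx => by simp [h2 hx], h3⟩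

/-- A set of vertices of a path spans a subpath whose ends belong to the set. -/
lemma exists_spanning_subpath {T : Set V} {u v : V} (p : G.Walk u v) (hp : p.IsPath)
    (hne : T.Nonempty) (hT : ∀ t ∈ T, t ∈ p.support) :
    ∃ a ∈ T, ∃ b ∈ T, ∃ q : G.Walk a b, q.IsPath ∧ q.support ⊆ p.support ∧
      ∀ t ∈ T, t ∈ q.support := by
  obtain ⟨a, ha, q, h1, h2, h3⟩ := exists_subpath_start_mem p hp hne hT
  obtain ⟨b, hb, r, h4, h5, h6⟩ := exists_subpath_start_mem q.reverse h1.reverse hne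
    (by simpa using h3)
  obtain ⟨a', ha', r', h7, h8, h9⟩ := exists_subpath_start_mem r.reverse h4.reverse hne
    (by simpa using h6)
  exact ⟨a', ha', b, hb, r', h7, fun x hx => h2 (by simpa using h5 (by simpa using h8 hx)), h9⟩

lemma exists_path_in_support {u v a b : V} (p : G.Walk u v) (ha : a ∈ p.support)
    (hb : b ∈ p.support) : ∃ q : G.Walk a b, q.IsPath ∧ q.support ⊆ p.support := by
  classical
  refine ⟨((p.takeUntil a ha).reverse.append (p.takeUntil b hb)).bypass,
    Walk.bypass_isPath _, fun x hx => ?_⟩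
  have := Walk.support_bypass_subset_support _ hx
  simp only [Walk.mem_support_append_iff, Walk.support_reverse, List.mem_reverse] at this
  rcases this with h | h <;> exact Walk.support_takeUntil_subset_support _ _ h

/-- A bramble without small transversals, whose members contain paths of large rank, has a
member linked to a long cycle disjoint from it. -/
theorem IsBramble.exists_cycle_linkage [Fintype V] (hF : IsBramble G F) (hne : F.Nonempty)
    {s z : ℕ} (hz : 0 < z) (hs : Fintype.card V < s * s)
    (hT : ∀ S : Finset V, S.card ≤ 2 * (s + z) + 2 * s → ∃ Q ∈ F, Disjoint Q (S : Set V))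
    (hpath : ∀ Q ∈ F, ∃ a b : V, ∃ p : G.Walk a b, p.IsPath ∧ (∀ x ∈ p.support, x ∈ Q) ∧
      s + z ≤ rank G F {x | x ∈ p.support}) :
    ∃ R ∈ F, ∃ w : V, ∃ c : G.Walk w w, c.IsCycle ∧ z + 2 ≤ c.length ∧
      (∀ x ∈ c.support, x ∉ R) ∧ Nonempty (Linkage G {x | x ∈ c.support} R (Fin z)) := by
  classical
  obtain ⟨P, hP⟩ := hne
  obtain ⟨_, _, p0, hp0, -, hp0r⟩ := hpath P hP
  obtain ⟨_, _, pA, hpA, -, hAr⟩ := exists_subpath_rank_eq (y := s + z) (by omega) p0 hp0 hp0r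
  set A : Set V := {x | x ∈ pA.support} with hAdef
  obtain ⟨X, hX, hXc⟩ := exists_blocks_card_eq (G := G) (F := F) A
  rw [hAr] at hXc
  obtain ⟨Q, hQ, hQX⟩ := hT X (by omega)
  obtain ⟨_, _, p1, hp1, hp1Q, hp1r⟩ := hpath Q hQ
  obtain ⟨_, _, pD, hpD, hpDsub, hDr⟩ := exists_subpath_rank_eq (y := s + z) (by omega) p1 hp1 hp1r
  set D : Set V := {x | x ∈ pD.support} with hDdef
  have hDQ : D ⊆ Q := fun x hx => hp1Q x (hpDsub hx)
  obtain ⟨Y, hY, hYc⟩ := exists_blocks_card_eq (G := G) (F := F) D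
  rw [hDr] at hYc
  have hAD : ∀ x ∈ A, x ∉ D := fun x hx hxD =>
    Set.disjoint_left.1 (hX.disjoint hQ hQX) hx (hDQ hxD)
  obtain ⟨L⟩ := menger (s + z) G A D (fun S hS => by
    by_contra! hlt
    exact hF.not_separates (hAr.symm ▸ hlt) (hDr.symm ▸ hlt) hS)
  -- the short links
  let K : Finset (Fin (s + z)) := Finset.univ.filter fun k => (L.walk k).support.length ≤ s
  -- The other links are disjoint with more than `s` vertices each, so there are fewer than `s` of
  -- them.
  have hKcard : z + 1 ≤ K.card := by
    have h1 := Finset.card_add_card_compl K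
    rw [Fintype.card_fin] at h1
    have h2 : Kᶜ.card * s ≤ Fintype.card V := by
      calc Kᶜ.card * s ≤ ∑ k ∈ Kᶜ, (L.walk k).support.toFinset.card := by
            rw [← smul_eq_mul]
            refine Finset.card_nsmul_le_sum _ _ _ ?_
            intro k hk
            rw [List.toFinset_card_of_nodup (L.isPath k).support_nodup]
            simp [K] at hk
            rw [Walk.length_support]
            omega
        _ = (Kᶜ.biUnion fun k => (L.walk k).support.toFinset).card := by
            rw [Finset.card_biUnion]
            intro i _ j _ hij
            rw [Function.onFun, Finset.disjoint_left]
            intro v hi hj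
            exact hij (L.disj i j v (by simpa using hi) (by simpa using hj))
        _ ≤ Fintype.card V := Finset.card_le_univ _
    have h3 : Kᶜ.card < s := by
      by_contra! h
      have := Nat.mul_le_mul_right s h
      omega
    omega
  have hKsrc : (K.image L.src).card = K.card := Finset.card_image_of_injective _ L.src_injective
  obtain ⟨a, ha, b, hb, qA, hqA, hqAsub, hqAT⟩ :=
    exists_spanning_subpath (T := ((K.image L.src : Finset V) : Set V)) pA hpA
      (by rw [Finset.coe_nonempty, Finset.image_nonempty, ← Finset.card_pos]; omega)
      (by
        intro t ht
        simp only [Finset.coe_image, Set.mem_image] at ht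
        obtain ⟨k, -, rfl⟩ := ht
        exact L.src_mem k)
  have hqAlen : z ≤ qA.length := by
    have : K.image L.src ⊆ qA.support.toFinset := by
      intro t ht
      simpa using hqAT t (by simpa using ht)
    have := (Finset.card_le_card this).trans (List.toFinset_card_le _)
    rw [Walk.length_support] at this
    omega
  simp only [Finset.coe_image, Set.mem_image, Finset.mem_coe] at ha hb
  obtain ⟨i, hi, rfl⟩ := ha
  obtain ⟨j, hj, rfl⟩ := hb
  have hij : i ≠ j := by
    rintro rfl
    rw [Walk.isPath_iff_nil] at hqA
    simp [Walk.length_eq_zero_iff.2 hqA] at hqAlen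
    omega
  have hqAA : ∀ x ∈ qA.support, x ∈ A := fun x hx => hqAsub hx
  obtain ⟨qD, hqD, hqDsub⟩ := exists_path_in_support pD (L.tgt_mem j) (L.tgt_mem i)
  have hqDD : ∀ x ∈ qD.support, x ∈ D := fun x hx => hqDsub hx
  have hP1 : (qA.append (L.walk j)).IsPath := isPath_append hqA (L.isPath j)
    fun x hx hx' => L.eq_src j x hx' (hqAA x hx)
  have hP2 : (qD.append (L.walk i).reverse).IsPath := isPath_append hqD (L.isPath i).reverse
    fun x hx hx' => L.eq_tgt i x (by simpa using hx') (hqDD x hx)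
  have hlen : ∀ k, 1 ≤ (L.walk k).length := by
    intro k
    by_contra! h
    have h0 := Walk.eq_of_length_eq_zero (p := L.walk k) (by omega)
    exact hAD _ (L.src_mem k) (h0 ▸ L.tgt_mem k)
  let c := (qA.append (L.walk j)).append (qD.append (L.walk i).reverse)
  have hcyc : c.IsCycle := by
    refine hP1.isCycle_append hP2 ?_ ?_
    · intro x hx hx'
      have hxa : x ≠ L.src i := by
        rintro rfl
        have := hP1.support_nodup
        rw [← Walk.cons_tail_support, List.nodup_cons] at this
        exact this.1 hx
      have hxd : x ≠ L.tgt j := by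
        rintro rfl
        have := hP2.support_nodup
        rw [← Walk.cons_tail_support, List.nodup_cons] at this
        exact this.1 hx'
      have h1 := List.mem_of_mem_tail hx
      have h2 := List.mem_of_mem_tail hx'
      simp only [Walk.mem_support_append_iff, Walk.support_reverse, List.mem_reverse] at h1 h2
      rcases h1 with h1 | h1 <;> rcases h2 with h2 | h2
      · exact hAD x (hqAA x h1) (hqDD x h2)
      · exact hxa (L.eq_src i x h2 (hqAA x h1))
      · exact hxd (L.eq_tgt j x h1 (hqDD x h2))
      · exact hij (L.disj i j x h2 h1)
    · left
      have := hlen j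
      rw [Walk.length_append]
      omega
  have hcsupp : ∀ x ∈ c.support, x ∈ A ∨ x ∈ D ∨ x ∈ (L.walk i).support ∨
      x ∈ (L.walk j).support := by
    intro x hx
    simp only [c, Walk.mem_support_append_iff, Walk.support_reverse, List.mem_reverse] at hx
    rcases hx with (hx | hx) | (hx | hx)
    · exact Or.inl (hqAA x hx)
    · exact Or.inr (Or.inr (Or.inr hx))
    · exact Or.inr (Or.inl (hqDD x hx))
    · exact Or.inr (Or.inr (Or.inl hx))
  -- The budget in `hT` is spent here: `s + z` for each of `X` and `Y`, and `s` for each of the two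
  -- short links.
  obtain ⟨R, hR, hRd⟩ := hT (X ∪ Y ∪ (L.walk i).support.toFinset ∪ (L.walk j).support.toFinset) (by
    have h1 := Finset.card_union_le (X ∪ Y ∪ (L.walk i).support.toFinset)
      (L.walk j).support.toFinset
    have h2 := Finset.card_union_le (X ∪ Y) (L.walk i).support.toFinset
    have h3 := Finset.card_union_le X Y
    have h4 := List.toFinset_card_le (L.walk i).support
    have h5 := List.toFinset_card_le (L.walk j).support
    have h6 := (Finset.mem_filter.1 hi).2
    have h7 := (Finset.mem_filter.1 hj).2
    omega)
  simp only [Finset.coe_union, Set.disjoint_union_right] at hRd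
  obtain ⟨⟨⟨hRX, hRY⟩, hRi⟩, hRj⟩ := hRd
  have hcR : ∀ x ∈ c.support, x ∉ R := by
    intro x hx hxR
    rcases hcsupp x hx with h | h | h | h
    · exact Set.disjoint_left.1 (hX.disjoint hR hRX) h hxR
    · exact Set.disjoint_left.1 (hY.disjoint hR hRY) h hxR
    · exact Set.disjoint_left.1 hRi hxR (by simpa using h)
    · exact Set.disjoint_left.1 hRj hxR (by simpa using h)
  refine ⟨R, hR, _, c, hcyc, ?_, hcR, menger z G _ _ fun S hS => ?_⟩
  · have h1 := hlen i
    have h2 := hlen j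
    simp only [c, Walk.length_append, Walk.length_reverse]
    omega
  -- All sources of the links in `K` lie on the cycle, so separating it from `R` takes at least
  -- `K.card` vertices.
  · have := hF.card_le_of_separates (O := {x | x ∈ c.support}) hX (by simpa using hXc)
      (by simp [hAr]) L hQ hQX hDQ hR hRX K ?_ S hS
    · omega
    · intro k hk
      have := hqAT (L.src k) (by simpa using ⟨k, hk, rfl⟩)
      simp only [c, Walk.mem_support_append_iff, Set.mem_ofPred_eq]
      exact Or.inl (Or.inl this)

end Cycle

/-! ### Detours through the cycle and the spacing of link ends on routes. -/

section Gap

variable {V : Type*} {G : SimpleGraph V}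

/-- Two distinct vertices of a cycle are joined by an arc of at least half its length. -/
lemma exists_long_arc {w a b : V} (c : G.Walk w w) (hc : c.IsCycle) (ha : a ∈ c.support)
    (hb : b ∈ c.support) (hab : a ≠ b) :
    ∃ q : G.Walk a b, q.IsPath ∧ (∀ x ∈ q.support, x ∈ c.support) ∧ c.length ≤ 2 * q.length := by
  classical
  set c' := c.rotate a ha with hc'
  have hc'cyc : c'.IsCycle := hc.rotate ha
  have hmem : ∀ x, x ∈ c'.support ↔ x ∈ c.support := fun x => Walk.mem_support_rotate_iff ..
  have hlen : c'.length = c.length := Walk.length_rotate ..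
  have hb' : b ∈ c'.support := (hmem b).2 hb
  have hspec := c'.take_spec hb'
  have hl : (c'.takeUntil b hb').length + (c'.dropUntil b hb').length = c.length := by
    rw [← hlen, ← Walk.length_append, hspec]
  by_cases h : c.length ≤ 2 * (c'.takeUntil b hb').length
  · exact ⟨_, hc'cyc.isPath_takeUntil hb', fun x hx =>
      (hmem x).1 (Walk.support_takeUntil_subset_support _ _ hx), h⟩
  · refine ⟨(c'.dropUntil b hb').reverse, ?_, ?_, ?_⟩
    · refine Walk.IsPath.reverse (Walk.IsCycle.isPath_of_append_right (p := c'.takeUntil b hb') ?_ ?_)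
      · exact Walk.not_nil_of_ne hab
      · rw [hspec]; exact hc'cyc
    · intro x hx
      rw [Walk.support_reverse, List.mem_reverse] at hx
      exact (hmem x).1 (Walk.support_dropUntil_subset_support _ _ hx)
    · rw [Walk.length_reverse]
      omega

/-- Back along link `i`, around the longer arc, out along link `j`. Each link has an edge because
the cycle misses `R`; doubled, the two links account for the `4`. -/
lemma Linkage.exists_long_detour {R : Set V} {ι : Type*} {w : V} (c : G.Walk w w)
    (hc : c.IsCycle) (hcR : ∀ x ∈ c.support, x ∉ R) (L : Linkage G {x | x ∈ c.support} R ι)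
    {i j : ι} (hij : i ≠ j) :
    ∃ q : G.Walk (L.tgt i) (L.tgt j), q.IsPath ∧
      (∀ x ∈ q.support, x ∈ R → x = L.tgt i ∨ x = L.tgt j) ∧ c.length + 4 ≤ 2 * q.length := by
  obtain ⟨q, hq, hqc, hqlen⟩ := exists_long_arc c hc (L.src_mem i) (L.src_mem j)
    (fun h => hij (L.src_injective h))
  have hlen : ∀ k, 1 ≤ (L.walk k).length := by
    intro k
    by_contra! h
    have h0 := Walk.eq_of_length_eq_zero (p := L.walk k) (by omega)
    exact hcR _ (L.src_mem k) (h0 ▸ L.tgt_mem k)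
  have h1 : (q.append (L.walk j)).IsPath := isPath_append hq (L.isPath j)
    fun x hx hx' => L.eq_src j x hx' (hqc x hx)
  refine ⟨(L.walk i).reverse.append (q.append (L.walk j)),
    isPath_append (L.isPath i).reverse h1 ?_, ?_, ?_⟩
  · intro x hx hx'
    rw [Walk.support_reverse, List.mem_reverse] at hx
    rw [Walk.mem_support_append_iff] at hx'
    rcases hx' with hx' | hx'
    · exact L.eq_src i x hx (hqc x hx')
    · exact absurd (L.disj i j x hx hx') hij
  · intro x hx hxR
    simp only [Walk.mem_support_append_iff, Walk.support_reverse, List.mem_reverse] at hx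
    rcases hx with hx | hx | hx
    · exact Or.inl (L.eq_tgt i x hx hxR)
    · exact absurd hxR (hcR x (hqc x hx))
    · exact Or.inr (L.eq_tgt j x hx hxR)
  · have h2 := hlen i
    have h3 := hlen j
    simp only [Walk.length_append, Walk.length_reverse]
    omega

/-- If any two of the vertices in `T` cut a segment of length at least `g` out of a walk, then
the walk is long. -/
lemma card_mul_le_length {u v : V} (w : G.Walk u v) (T : Finset V) (hT : ∀ t ∈ T, t ∈ w.support)
    {g : ℕ} (hg : 0 < g)
    (h : ∀ a ∈ T, ∀ b ∈ T, a ≠ b → ∀ (p₁ : G.Walk u a) (p₂ : G.Walk a b) (p₃ : G.Walk b v),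
      w = p₁.append (p₂.append p₃) → g ≤ p₂.length) :
    T.card * g ≤ w.length + g := by
  classical
  let f : V → ℕ := fun a => if ha : a ∈ w.support then (w.takeUntil a ha).length else 0
  have hf : ∀ a (ha : a ∈ w.support), f a = (w.takeUntil a ha).length := fun a ha => dif_pos ha
  have hgap : ∀ a ∈ T, ∀ b ∈ T, a ≠ b → f a ≤ f b → f a + g ≤ f b := by
    intro a ha b hb hab hle
    have ha' := hT a ha
    have hb' := hT b hb
    rw [hf a ha', hf b hb'] at hle ⊢
    have hmem : a ∈ (w.takeUntil b hb').support := by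
      rw [Walk.mem_support_iff_exists_getVert]
      refine ⟨(w.takeUntil a ha').length, ?_, hle⟩
      rw [Walk.getVert_takeUntil hb' hle, Walk.getVert_length_takeUntil]
    have h1 := h a ha b hb hab ((w.takeUntil b hb').takeUntil a hmem)
      ((w.takeUntil b hb').dropUntil a hmem) (w.dropUntil b hb') (by
        rw [Walk.append_assoc, Walk.take_spec, Walk.take_spec])
    have h2 : (w.takeUntil b hb').length = ((w.takeUntil b hb').takeUntil a hmem).length +
        ((w.takeUntil b hb').dropUntil a hmem).length := by
      rw [← Walk.length_append, Walk.take_spec]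
    rw [Walk.takeUntil_takeUntil] at h2
    omega
  -- First-visit positions differ by at least `g`, so their quotients by `g` are distinct.
  have hcard : T.card ≤ w.length / g + 1 := by
    rw [← Finset.card_range (w.length / g + 1)]
    refine Finset.card_le_card_of_injOn (fun a => f a / g) ?_ ?_
    · intro a ha
      have ha' := hT a ha
      simp only [Finset.coe_range, Set.mem_Iio, hf a ha']
      exact Nat.lt_succ_of_le (Nat.div_le_div_right (Walk.length_takeUntil_le_length _ _))
    · intro a ha b hb hab
      by_contra hne
      simp only at hab
      have key : ∀ x y : ℕ, x + g ≤ y → x / g ≠ y / g := by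
        intro x y hxy heq
        have h1 := Nat.div_le_div_right (c := g) hxy
        rw [Nat.add_div_right _ hg] at h1
        omega
      rcases le_total (f a) (f b) with hle | hle
      · exact key _ _ (hgap a ha b hb hne hle) hab
      · exact key _ _ (hgap b hb a ha (Ne.symm hne) hle) hab.symm
  calc T.card * g ≤ (w.length / g + 1) * g := Nat.mul_le_mul_right g hcard
    _ = w.length / g * g + g := by ring
    _ ≤ w.length + g := Nat.add_le_add_right (Nat.div_mul_le_self _ _) g

/-- If no route can be lengthened by a detour, then few links lead to a long cycle. -/
lemma Linkage.card_mul_le {R : Set V} {E : Type*} [Fintype E] {s t : E → V}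
    (route : ∀ e, G.Walk (s e) (t e)) (hR : ∀ x ∈ R, ∃ e, x ∈ (route e).support)
    (hmax : ∀ e a b, a ≠ b → ∀ (p₁ : G.Walk (s e) a) (p₂ : G.Walk a b) (p₃ : G.Walk b (t e)),
      route e = p₁.append (p₂.append p₃) → ∀ q : G.Walk a b, q.IsPath → 2 ≤ q.length →
      (∀ x ∈ q.support, x ∈ R → x = a ∨ x = b) → q.length ≤ p₂.length)
    {w : V} (c : G.Walk w w) (hc : c.IsCycle) (hcR : ∀ x ∈ c.support, x ∉ R) {z g : ℕ}
    (L : Linkage G {x | x ∈ c.support} R (Fin z)) (hg : 0 < g) (hgc : 2 * g ≤ c.length + 4) :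
    z * g ≤ ∑ e, (route e).length + Fintype.card E * g := by
  classical
  -- A link end may lie on several routes; it is charged to one of them.
  choose r hr using fun i => hR (L.tgt i) (L.tgt_mem i)
  let T : E → Finset V := fun e => (Finset.univ.filter fun i => r i = e).image L.tgt
  have hTcard : z = ∑ e, (T e).card := by
    have : ∀ e, (T e).card = (Finset.univ.filter fun i => r i = e).card := fun e =>
      Finset.card_image_of_injective _ L.tgt_injective
    simp only [this]
    simpa using Finset.card_eq_sum_card_fiberwise (s := Finset.univ) (t := Finset.univ) (f := r)
      (fun _ _ => by simp)
  have hT : ∀ e, (T e).card * g ≤ (route e).length + g := by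
    intro e
    refine card_mul_le_length (route e) (T e) ?_ hg ?_
    · intro x hx
      simp only [T, Finset.mem_image, Finset.mem_filter, Finset.mem_univ, true_and] at hx
      obtain ⟨i, rfl, rfl⟩ := hx
      exact hr i
    · intro a ha b hb hab p₁ p₂ p₃ heq
      simp only [T, Finset.mem_image, Finset.mem_filter, Finset.mem_univ, true_and] at ha hb
      obtain ⟨i, -, rfl⟩ := ha
      obtain ⟨j, -, rfl⟩ := hb
      obtain ⟨q, hq, hqR, hqlen⟩ := L.exists_long_detour c hc hcR (i := i) (j := j)
        (fun h => hab (h ▸ rfl))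
      have := hmax e _ _ hab p₁ p₂ p₃ heq q hq (by have := hc.three_le_length; omega) hqR
      omega
  calc z * g = ∑ e, (T e).card * g := by rw [← Finset.sum_mul, ← hTcard]
    _ ≤ ∑ e, ((route e).length + g) := Finset.sum_le_sum fun e _ => hT e
    _ = _ := by rw [Finset.sum_add_distrib]; simp

end Gap

/-! ### Replacing a segment of a path or cycle. -/

section Detour

variable {V : Type*} {G : SimpleGraph V}

/-- Meant for supports cut into a first part and tails, where `a` is gone from the middle list and
`b` is its last entry. Since `b` is in `Y`, it is in neither `X` nor `Z`. -/
lemma nodup_append_replace {X Y Y' Z : List V} {b : V} (h : (X ++ (Y ++ Z)).Nodup) (hb : b ∈ Y)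
    (hY' : Y'.Nodup) (hd : ∀ v ∈ Y', v ∈ X ∨ v ∈ Z → v = b) : (X ++ (Y' ++ Z)).Nodup := by
  simp only [List.nodup_append', List.Disjoint, List.mem_append] at h ⊢
  refine ⟨h.1, ⟨hY', h.2.1.2.1, ?_⟩, ?_⟩
  · intro v hv hZ
    exact h.2.1.2.2 hb (hd v hv (Or.inr hZ) ▸ hZ)
  · rintro v hv (hv' | hv')
    · exact h.2.2 (hd v hv' (Or.inl hv) ▸ hv) (Or.inl hb)
    · exact h.2.2 hv (Or.inr hv')

variable {u v a b : V} {p₁ : G.Walk u a} {p₂ : G.Walk a b} {p₃ : G.Walk b v} {q : G.Walk a b}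

lemma notMem_support_tail (hq : q.IsPath) : a ∉ q.support.tail := by
  have := hq.support_nodup
  rw [← Walk.cons_tail_support, List.nodup_cons] at this
  exact this.1

lemma isPath_replace (h : (p₁.append (p₂.append p₃)).IsPath) (hab : a ≠ b) (hq : q.IsPath)
    (hd : ∀ x ∈ q.support, x ∈ (p₁.append (p₂.append p₃)).support → x = a ∨ x = b) :
    (p₁.append (q.append p₃)).IsPath := by
  rw [Walk.isPath_def, Walk.support_append, Walk.tail_support_append] at h ⊢
  refine nodup_append_replace h (p₂.end_mem_tail_support (Walk.not_nil_of_ne hab))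
    hq.support_nodup.tail ?_
  intro x hx hx'
  refine (hd x (List.mem_of_mem_tail hx) ?_).resolve_left ?_
  · simp only [Walk.mem_support_append_iff]
    rcases hx' with hx' | hx'
    · exact Or.inl hx'
    · exact Or.inr (Or.inr (List.mem_of_mem_tail hx'))
  · rintro rfl
    exact notMem_support_tail hq hx

/-- An edge inside `W` would be `ab`, and a path containing the edge between its own ends has length
1. -/
lemma exists_notMem_of_mem_edges {W : Set V} (hq : q.IsPath) (hlen : 2 ≤ q.length)
    (hd : ∀ x ∈ q.support, x ∈ W → x = a ∨ x = b) {e : Sym2 V} (he : e ∈ q.edges) :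
    ∃ x ∈ e, x ∉ W := by
  by_contra! hcon
  induction e with
  | _ x y =>
  have hx := hd x (q.fst_mem_support_of_mem_edges he) (hcon x (by simp))
  have hy := hd y (q.snd_mem_support_of_mem_edges he) (hcon y (by simp))
  have hne := (q.adj_of_mem_edges he).ne
  have : s(a, b) ∈ q.edges := by
    rcases hx with rfl | rfl <;> rcases hy with rfl | rfl
    · exact absurd rfl hne
    · exact he
    · rw [Sym2.eq_swap]; exact he
    · exact absurd rfl hne
  have := hq.length_eq_one_of_mem_edges this
  omega

lemma isCycle_copy_iff (w : G.Walk u v) (h : v = u) :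
    (w.copy rfl h).IsCycle ↔ w.IsTrail ∧ 0 < w.length ∧ w.support.tail.Nodup := by
  subst h
  rw [Walk.copy_rfl_rfl, Walk.isCycle_def, Nat.pos_iff_ne_zero, Ne, Ne, Walk.length_eq_zero_iff,
    Walk.eq_nil_iff_nil]

/-- Length at least 2 matters: a single edge `ab` could already be the rest of the cycle. Otherwise
every edge of `q` has an end off the old cycle, so the new walk is a trail. -/
lemma isCycle_replace (h : v = u) (hc : ((p₁.append (p₂.append p₃)).copy rfl h).IsCycle)
    (hab : a ≠ b) (hq : q.IsPath) (hlen : 2 ≤ q.length)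
    (hd : ∀ x ∈ q.support, x ∈ (p₁.append (p₂.append p₃)).support → x = a ∨ x = b) :
    ((p₁.append (q.append p₃)).copy rfl h).IsCycle := by
  rw [isCycle_copy_iff] at hc ⊢
  obtain ⟨h1, h2, h3⟩ := hc
  refine ⟨?_, ?_, ?_⟩
  · have hsub : ∀ e, e ∈ p₁.edges ∨ e ∈ p₃.edges → e ∉ q.edges := by
      intro e he heq
      obtain ⟨x, hx, hxW⟩ := exists_notMem_of_mem_edges
        (W := {x | x ∈ (p₁.append (p₂.append p₃)).support}) hq hlen hd heq
      refine hxW ?_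
      simp only [Set.mem_ofPred_eq, Walk.mem_support_append_iff]
      rcases he with he | he
      · exact Or.inl (Walk.mem_support_of_mem_edges he hx)
      · exact Or.inr (Or.inr (Walk.mem_support_of_mem_edges he hx))
    rw [Walk.isTrail_def] at h1 ⊢
    simp only [Walk.edges_append, List.nodup_append', List.Disjoint, List.mem_append] at h1 ⊢
    refine ⟨h1.1, ⟨hq.isTrail.edges_nodup, h1.2.1.2.1, fun e he he' => hsub e (Or.inr he') he⟩, ?_⟩
    rintro e he (he' | he')
    · exact hsub e (Or.inl he) he'
    · exact h1.2.2 he (Or.inr he')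
  · simp only [Walk.length_append]; omega
  · rw [Walk.tail_support_append, Walk.tail_support_append] at h3 ⊢
    refine nodup_append_replace h3 (p₂.end_mem_tail_support (Walk.not_nil_of_ne hab))
      hq.support_nodup.tail ?_
    intro x hx hx'
    refine (hd x (List.mem_of_mem_tail hx) ?_).resolve_left ?_
    · simp only [Walk.mem_support_append_iff]
      rcases hx' with hx' | hx'
      · exact Or.inl (List.mem_of_mem_tail hx')
      · exact Or.inr (Or.inr (List.mem_of_mem_tail hx'))
    · rintro rfl
      exact notMem_support_tail hq hx

end Detour

/-! ### Numerical estimates. -/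

section Numerics

lemma rpow_third_sq (n : ℕ) : ((n : ℝ) ^ ((1 : ℝ) / 3)) ^ 2 = (n : ℝ) ^ ((2 : ℝ) / 3) := by
  rw [← Real.rpow_natCast, ← Real.rpow_mul (Nat.cast_nonneg n)]
  norm_num

lemma rpow_third_cube (n : ℕ) : ((n : ℝ) ^ ((1 : ℝ) / 3)) ^ 3 = n := by
  rw [← Real.rpow_natCast, ← Real.rpow_mul (Nat.cast_nonneg n)]
  norm_num

lemma le_five_mul_rpow {n : ℕ} (hn : n ≤ 125) : (n : ℝ) ≤ 5 * (n : ℝ) ^ ((2 : ℝ) / 3) := by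
  rw [← rpow_third_sq]
  have h3 := rpow_third_cube n
  set N := (n : ℝ) ^ ((1 : ℝ) / 3) with hN
  have hN0 : 0 ≤ N := by positivity
  have hN5 : N ≤ 5 := by
    by_contra! h
    have : (5 : ℝ) ^ 3 < N ^ 3 := by gcongr
    have h' : (n : ℝ) ≤ 125 := by exact_mod_cast hn
    linarith
  rw [← h3]
  nlinarith [mul_nonneg (sq_nonneg N) (sub_nonneg.2 hN5)]

/-- Here `r` is the sixth root of n. For m up to √(5/2)·r the leading term is at most
(5/2)^(3/2)·r⁴, below 5r⁴; beyond that, 2mr² exceeds 3.1r³ and dominates the bracket. The decimals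
round √5 and √(5/2). -/
lemma mul_add_le_max {r m : ℝ} (hr : 5 ≤ r ^ 2) (hr0 : 0 < r) (hm : 0 < m) :
    m * (5 / 2 * r ^ 3 + 2 + m) ≤ max (5 * (r ^ 2) ^ 2) (2 * m ^ 2 * r ^ 2) := by
  have hr2 : 2.2 ≤ r := by nlinarith
  by_cases h : m ^ 2 ≤ 5 / 2 * r ^ 2
  · refine le_max_of_le_left ?_
    have hm1 : m ≤ 1.582 * r := by
      by_contra! hc
      nlinarith [mul_pos hr0 hr0]
    have h1 : m * (5 / 2 * r ^ 3) ≤ 1.582 * r * (5 / 2 * r ^ 3) := by gcongr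
    have h2 : 5 * r ^ 2 ≤ r ^ 2 * r ^ 2 := by gcongr
    have h3 : 2.2 * r ≤ r * r := by gcongr
    nlinarith
  · refine le_max_of_le_right ?_
    push Not at h
    have hm1 : 1.58 * r ≤ m := by
      by_contra! hc
      nlinarith [mul_pos hr0 hr0]
    have h1 : 1.58 * r * (2 * r ^ 2 - 1) ≤ m * (2 * r ^ 2 - 1) := by
      apply mul_le_mul_of_nonneg_right hm1; linarith
    have h2 : 5 * r ≤ r ^ 2 * r := by gcongr
    have h3 : 5 / 2 * r ^ 3 + 2 + m ≤ 2 * m * r ^ 2 := by nlinarith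
    calc m * (5 / 2 * r ^ 3 + 2 + m) ≤ m * (2 * m * r ^ 2) := by gcongr
      _ = 2 * m ^ 2 * r ^ 2 := by ring

/-- The two lower bounds for the transversal number that the main argument uses. -/
lemma bounds_le_max {n m s h : ℕ} (hn : 125 < n) (hm : 0 < m) (hmn : m ^ 3 < n)
    (hs : s ≤ Nat.sqrt n + 1) (hh : 2 * h ≤ 3 * s + 1) :
    ((2 * (s + (h + m)) + 2 * s : ℕ) : ℝ) ≤ max (5 * (n : ℝ) ^ ((2 : ℝ) / 3))
        (2 * (m : ℝ) ^ 2 * (n : ℝ) ^ ((1 : ℝ) / 3)) ∧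
      ((m * (s + (h + m) - 1) : ℕ) : ℝ) ≤ max (5 * (n : ℝ) ^ ((2 : ℝ) / 3))
        (2 * (m : ℝ) ^ 2 * (n : ℝ) ^ ((1 : ℝ) / 3)) := by
  rw [← rpow_third_sq]
  have h3 := rpow_third_cube n
  set N := (n : ℝ) ^ ((1 : ℝ) / 3) with hN
  have hN0 : 0 ≤ N := by positivity
  set r := Real.sqrt N with hr
  have hrN : r ^ 2 = N := Real.sq_sqrt hN0
  have hr0' : 0 ≤ r := Real.sqrt_nonneg _
  have hN5 : 5 ≤ N := by
    by_contra! hc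
    have : N ^ 3 < (5 : ℝ) ^ 3 := by gcongr
    have h' : (125 : ℝ) < n := by exact_mod_cast hn
    linarith
  have hr5 : 5 ≤ r ^ 2 := hrN ▸ hN5
  have hr0 : 0 < r := by
    rcases hr0'.eq_or_lt with h0 | h0
    · rw [← h0] at hr5; norm_num at hr5
    · exact h0
  have hr6 : (r ^ 3) ^ 2 = n := by rw [← h3, ← hrN]; ring
  have hmN : (m : ℝ) ≤ r ^ 2 := by
    rw [hrN]
    by_contra! hc
    have h1 : N ^ 3 < (m : ℝ) ^ 3 := by gcongr
    have h2 : ((m ^ 3 : ℕ) : ℝ) < n := by exact_mod_cast hmn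
    push_cast at h2
    linarith
  have hsqrt : (Nat.sqrt n : ℝ) ≤ r ^ 3 := by
    have h1 : ((Nat.sqrt n ^ 2 : ℕ) : ℝ) ≤ n := by exact_mod_cast Nat.sqrt_le' n
    push_cast at h1
    rw [← hr6] at h1
    exact (pow_le_pow_iff_left₀ (by positivity) (by positivity) two_ne_zero).1 h1
  have hs' : (s : ℝ) ≤ r ^ 3 + 1 := by
    have : (s : ℝ) ≤ Nat.sqrt n + 1 := by exact_mod_cast hs
    linarith
  have hh' : 2 * (h : ℝ) ≤ 3 * s + 1 := by exact_mod_cast hh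
  have hm0 : (0 : ℝ) < m := by exact_mod_cast hm
  rw [← hrN]
  constructor
  · refine le_max_of_le_left ?_
    push_cast
    have h1 : 5 * r ^ 2 ≤ r ^ 2 * r ^ 2 := by gcongr
    have hr2 : 2.2 ≤ r := by nlinarith
    have h2 : 2.2 * r ^ 3 ≤ r * r ^ 3 := by gcongr
    have h4 : 2.2 * r ^ 2 ≤ r * r ^ 2 := by gcongr
    nlinarith
  · refine le_trans ?_ (mul_add_le_max hr5 hr0 hm0)
    rw [Nat.cast_mul, Nat.cast_sub (by omega)]
    refine mul_le_mul_of_nonneg_left ?_ hm0.le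
    push_cast
    linarith

end Numerics

/-! ### The transversal bound for brambles. -/

section Transversal

variable {V : Type*} {G : SimpleGraph V} {F : Set (Set V)}

/-- A bramble whose members are unions of few paths and have few links to every long cycle
disjoint from them has a small transversal. -/
theorem IsBramble.exists_transversal [Fintype V] (hF : IsBramble G F) {E : Type*} [Fintype E]
    {m : ℕ} (hmE : Fintype.card E = m) (hm : 0 < m) (hn : m ^ 3 < Fintype.card V)
    (hcover : ∀ Q ∈ F, ∃ a b : E → V, ∃ p : ∀ e, G.Walk (a e) (b e),
      (∀ e, (p e).IsPath) ∧ Q = ⋃ e, {x | x ∈ (p e).support})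
    (hgap : ∀ R ∈ F, ∀ (w : V) (c : G.Walk w w), c.IsCycle → (∀ x ∈ c.support, x ∉ R) →
      ∀ z g : ℕ, Nonempty (Linkage G {x | x ∈ c.support} R (Fin z)) → 0 < g →
      2 * g ≤ c.length + 4 → z * g ≤ Fintype.card V + m + m * g) :
    ∃ S : Finset V, (∀ Q ∈ F, ∃ v ∈ S, v ∈ Q) ∧
      (S.card : ℝ) ≤ max (5 * (Fintype.card V : ℝ) ^ ((2 : ℝ) / 3))
        (2 * (m : ℝ) ^ 2 * (Fintype.card V : ℝ) ^ ((1 : ℝ) / 3)) := by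
  classical
  rcases F.eq_empty_or_nonempty with rfl | hne
  · exact ⟨∅, by simp, by simp; left; positivity⟩
  by_cases hsmall : Fintype.card V ≤ 125
  · refine ⟨Finset.univ, fun Q hQ => ?_, le_max_of_le_left (le_five_mul_rpow hsmall)⟩
    obtain ⟨v, hv, -⟩ := hF.intersecting Q hQ Q hQ
    exact ⟨v, Finset.mem_univ v, hv⟩
  push Not at hsmall
  set n := Fintype.card V with hndef
  -- The factor 3/2 in `h` makes h² at least 9s²/4, hence more than 2n. The links number `h + m` so
  -- that the extra `m` cancels the term `m * g` of `hgap`.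
  set s := Nat.sqrt n + 1 with hs
  set h := (3 * s + 1) / 2 with hh
  set B := max (5 * (n : ℝ) ^ ((2 : ℝ) / 3)) (2 * (m : ℝ) ^ 2 * (n : ℝ) ^ ((1 : ℝ) / 3)) with hB
  have hns : n < s * s := Nat.lt_succ_sqrt n
  obtain ⟨hb1, hb2⟩ := bounds_le_max (s := s) (h := h) hsmall hm hn le_rfl (by omega)
  by_contra! hcon
  have hT : ∀ S : Finset V, S.card ≤ ⌊B⌋₊ → ∃ Q ∈ F, Disjoint Q (S : Set V) := by
    intro S hS
    by_contra! hc
    refine absurd (hcon S fun Q hQ => ?_) (not_lt.2 ?_)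
    · obtain ⟨v, hvQ, hvS⟩ := Set.not_disjoint_iff.1 (hc Q hQ)
      exact ⟨v, hvS, hvQ⟩
    · exact (Nat.le_floor_iff (by positivity)).1 hS
  have hf1 : 2 * (s + (h + m)) + 2 * s ≤ ⌊B⌋₊ := Nat.le_floor hb1
  have hf2 : m * (s + (h + m) - 1) ≤ ⌊B⌋₊ := Nat.le_floor hb2
  obtain ⟨R, hR, w, c, hc, hclen, hcR, hL⟩ := hF.exists_cycle_linkage hne (s := s) (z := h + m)
    (by omega) hns (fun S hS => hT S (hS.trans hf1)) (by
      intro Q hQ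
      obtain ⟨a, b, p, hp, rfl⟩ := hcover Q hQ
      have hrank := hF.le_rank hT hQ
      -- If all m paths had rank at most `s + (h + m) - 1`, subadditivity would contradict the rank
      -- of the member.
      by_contra! hc
      have := rank_iUnion_le (G := G) (F := F) (fun e => {x | x ∈ (p e).support})
        (s + (h + m) - 1) (fun e => Nat.le_sub_one_of_lt
          (hc _ _ (p e) (hp e) fun x hx => Set.mem_iUnion.2 ⟨e, hx⟩))
      rw [hmE] at this
      omega)
  -- The cycle has length at least `h + m + 2`, which leaves room for this spacing.
  have key := hgap R hR w c hc hcR (h + m) ((h + m + 5) / 2) hL (by omega) (by omega)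
  have h1 : h * ((h + m + 5) / 2) ≤ n + m := by
    rw [add_mul] at key
    omega
  have h2 : h * (h + m + 4) ≤ 2 * (n + m) := by
    calc h * (h + m + 4) ≤ h * (2 * ((h + m + 5) / 2)) := Nat.mul_le_mul_left h (by omega)
      _ = 2 * (h * ((h + m + 5) / 2)) := by ring
      _ ≤ _ := Nat.mul_le_mul_left 2 h1
  have h3 : 3 * s ≤ 2 * h := by omega
  have h4 : 2 ≤ h := by omega
  nlinarith [Nat.mul_le_mul h3 h3, Nat.mul_le_mul_right m h4]

end Transversal

/-! ### Longest paths of a connected graph. -/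

section LongestPaths

variable {V : Type*} {G : SimpleGraph V}

/-- The vertex sets of the longest paths. -/
def longestPaths (G : SimpleGraph V) : Set (Set V) :=
  {P | ∃ (u v : V) (p : G.Walk u v), p.IsPath ∧
    (∀ (u' v' : V) (q : G.Walk u' v'), q.IsPath → q.length ≤ p.length) ∧
    P = {x | x ∈ p.support}}

lemma exists_half_path {u v a : V} (p : G.Walk u v) (hp : p.IsPath) (ha : a ∈ p.support) :
    ∃ b : V, ∃ q : G.Walk b a, q.IsPath ∧ q.support ⊆ p.support ∧ p.length ≤ 2 * q.length := by
  classical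
  have hl : (p.takeUntil a ha).length + (p.dropUntil a ha).length = p.length := by
    rw [← Walk.length_append, Walk.take_spec]
  by_cases h : p.length ≤ 2 * (p.takeUntil a ha).length
  · exact ⟨_, p.takeUntil a ha, hp.takeUntil ha, p.support_takeUntil_subset_support ha, h⟩
  · refine ⟨_, (p.dropUntil a ha).reverse, (hp.dropUntil ha).reverse, ?_, ?_⟩
    · intro x hx
      rw [Walk.support_reverse, List.mem_reverse] at hx
      exact p.support_dropUntil_subset_support ha hx
    · rw [Walk.length_reverse]; omega

/-- Two disjoint longest paths could be joined by a path; with the longer part of each it would beat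
them both. -/
lemma isBramble_longestPaths (hG : G.Connected) : IsBramble G (longestPaths G) := by
  classical
  refine ⟨?_, ?_⟩
  · rintro _ ⟨u, v, p, hp, -, rfl⟩ a ha b hb
    obtain ⟨q, -, hq⟩ := exists_path_in_support p ha hb
    exact ⟨q, fun x hx => hq hx⟩
  · rintro _ ⟨u, v, p, hp, hpmax, rfl⟩ _ ⟨u', v', q, hq, hqmax, rfl⟩
    by_contra hcon
    rw [Set.not_nonempty_iff_eq_empty, Set.eq_empty_iff_forall_notMem] at hcon
    have hdisj : ∀ x ∈ p.support, x ∉ q.support := fun x hx hx' => hcon x ⟨hx, hx'⟩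
    obtain ⟨w0⟩ := hG.preconnected u u'
    obtain ⟨a, b, w, ha, hb, hw, -, hwp, hwq⟩ := exists_trimmed_path
      (A := {x | x ∈ p.support}) (B := {x | x ∈ q.support}) w0 p.start_mem_support
      q.start_mem_support
    obtain ⟨a', p', hp', hp'sub, hp'len⟩ := exists_half_path p hp ha
    obtain ⟨b', q', hq', hq'sub, hq'len⟩ := exists_half_path q hq hb
    have h1 : (w.append q'.reverse).IsPath := isPath_append hw hq'.reverse
      fun x hx hx' => hwq x hx (hq'sub (by simpa using hx'))
    have h2 : (p'.append (w.append q'.reverse)).IsPath := by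
      refine isPath_append hp' h1 fun x hx hx' => ?_
      rw [Walk.mem_support_append_iff, Walk.support_reverse, List.mem_reverse] at hx'
      rcases hx' with hx' | hx'
      · exact hwp x hx' (hp'sub hx)
      · exact absurd (hq'sub hx') (hdisj x (hp'sub hx))
    have hwlen : 1 ≤ w.length := by
      by_contra! h
      have h0 := Walk.eq_of_length_eq_zero (p := w) (by omega)
      exact hdisj a ha (h0 ▸ hb)
    have h3 := hpmax _ _ _ h2
    have h4 := hqmax _ _ _ h2
    simp only [Walk.length_append, Walk.length_reverse] at h3 h4
    omega

/-- The whole path is the only route, so m = 1 and the second term of the maximum is the smaller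
one. -/
theorem exists_transversal_longestPaths [Fintype V] (hG : G.Connected) :
    ∃ S : Finset V, (S.card : ℝ) ≤ 5 * (Fintype.card V : ℝ) ^ ((2 : ℝ) / 3) ∧
      ∀ (u v : V) (p : G.Walk u v), p.IsPath →
        (∀ (u' v' : V) (q : G.Walk u' v'), q.IsPath → q.length ≤ p.length) →
        ∃ x ∈ S, x ∈ p.support := by
  classical
  by_cases hn : Fintype.card V ≤ 1
  · exact ⟨Finset.univ, by
      rw [Finset.card_univ]
      exact le_five_mul_rpow (by omega), fun u v p _ _ =>
      ⟨u, Finset.mem_univ u, p.start_mem_support⟩⟩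
  push Not at hn
  obtain ⟨S, hS, hcard⟩ := (isBramble_longestPaths hG).exists_transversal (E := Unit) (m := 1)
    (by simp) one_pos (by simpa using hn) (by
      rintro _ ⟨u, v, p, hp, -, rfl⟩
      exact ⟨fun _ => u, fun _ => v, fun _ => p, fun _ => hp, (Set.iUnion_const _).symm⟩) (by
      rintro _ ⟨u, v, p, hp, hpmax, rfl⟩ w c hc hcR z g ⟨L⟩ hg hgc
      have key := L.card_mul_le (fun _ : Unit => p) (fun x hx => ⟨(), hx⟩) (by
        intro _ a b hab p₁ p₂ p₃ heq q hq _ hqR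
        subst heq
        have := hpmax _ _ _ (isPath_replace hp hab hq hqR)
        simp only [Walk.length_append] at this
        omega) c hc hcR hg hgc
      have := hp.length_lt
      simp only [Finset.univ_unique, Finset.sum_const, Finset.card_singleton, one_smul,
        Fintype.card_unit] at key
      omega)
  refine ⟨S, hcard.trans (max_le le_rfl ?_), fun u v p hp hmax => hS _ ⟨u, v, p, hp, hmax, rfl⟩⟩
  rw [← rpow_third_sq]
  have h3 := rpow_third_cube (Fintype.card V)
  set N := (Fintype.card V : ℝ) ^ ((1 : ℝ) / 3)
  have hN0 : 0 ≤ N := by positivity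
  have hN1 : 1 ≤ N := by
    by_contra! hc
    have h1 : N ^ 3 ≤ 1 := pow_le_one₀ hN0 hc.le
    have : (1 : ℝ) < Fintype.card V := by exact_mod_cast hn
    linarith
  push_cast
  nlinarith

end LongestPaths

/-! ### Maximum subdivisions of a multigraph. -/

section Subdivisions

variable {α β V : Type*} {M : Graph α β} {G : SimpleGraph V}

lemma Subdivision.mem_verts (D : Subdivision M G) (x : V) :
    x ∈ D.toSubgraph.verts ↔ x ∈ Set.range D.branch ∨ ∃ e, x ∈ (D.route e).support := by
  simp [Subdivision.toSubgraph, eq_comm]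

lemma Subdivision.mem_edgeSet (D : Subdivision M G) (s : Sym2 V) :
    s ∈ D.toSubgraph.edgeSet ↔ ∃ e, s ∈ (D.route e).edges := by
  induction s with
  | _ x y =>
  simp [Subdivision.toSubgraph]

lemma Subdivision.isTrail_route (D : Subdivision M G) (e : M.edgeSet) : (D.route e).IsTrail := by
  by_cases h : D.tail e = D.head e
  · exact ((isCycle_copy_iff _ _).1 (D.isCycle_of_eq e h)).1
  · exact (D.isPath_of_ne e h).isTrail

lemma Subdivision.ncard_edgeSet [Fintype M.edgeSet] (D : Subdivision M G) :
    D.toSubgraph.edgeSet.ncard = ∑ e, (D.route e).length := by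
  classical
  have : D.toSubgraph.edgeSet =
      ((Finset.univ.biUnion fun e => (D.route e).edges.toFinset : Finset (Sym2 V)) : Set _) := by
    ext s
    simp [D.mem_edgeSet]
  rw [this, Set.ncard_coe_finset, Finset.card_biUnion]
  · refine Finset.sum_congr rfl fun e _ => ?_
    rw [List.toFinset_card_of_nodup (D.isTrail_route e).edges_nodup, Walk.length_edges]
  · intro e _ f _ hef
    rw [Function.onFun, Finset.disjoint_left]
    intro s hs hs'
    exact D.edges_disjoint e f hef (by simpa using hs) (by simpa using hs')

/-- Replacing a segment of a subdivided edge by a path that avoids the rest of the subdivision. -/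
lemma Subdivision.exists_replace [Fintype M.edgeSet] (D : Subdivision M G) (e₀ : M.edgeSet)
    {a b : V} (hab : a ≠ b) (p₁ : G.Walk (D.branch (D.tail e₀)) a) (p₂ : G.Walk a b)
    (p₃ : G.Walk b (D.branch (D.head e₀))) (heq : D.route e₀ = p₁.append (p₂.append p₃))
    (q : G.Walk a b) (hq : q.IsPath) (hlen : 2 ≤ q.length)
    (hqD : ∀ x ∈ q.support, x ∈ D.toSubgraph.verts → x = a ∨ x = b) :
    ∃ D' : Subdivision M G, ∑ e, (D'.route e).length + p₂.length =
      ∑ e, (D.route e).length + q.length := by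
  classical
  set w := p₁.append (q.append p₃) with hw
  have hverts : ∀ e, ∀ x ∈ (D.route e).support, x ∈ D.toSubgraph.verts := fun e x hx =>
    (D.mem_verts x).2 (Or.inr ⟨e, hx⟩)
  have hbranch : ∀ x, D.branch x ∈ D.toSubgraph.verts := fun x =>
    (D.mem_verts _).2 (Or.inl ⟨x, rfl⟩)
  have hqw : ∀ x ∈ q.support, x ∈ (p₁.append (p₂.append p₃)).support → x = a ∨ x = b :=
    fun x hx hx' => hqD x hx (hverts e₀ x (heq ▸ hx'))
  -- The new route meets the old subdivision only within the route it replaces, so the vertex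
  -- conditions are inherited.
  have hold : ∀ x ∈ w.support, x ∈ D.toSubgraph.verts → x ∈ (D.route e₀).support := by
    intro x hx hxD
    rw [heq]
    simp only [hw, Walk.mem_support_append_iff] at hx ⊢
    rcases hx with hx | hx | hx
    · exact Or.inl hx
    · rcases hqD x hx hxD with rfl | rfl
      · exact Or.inl p₁.end_mem_support
      · exact Or.inr (Or.inr p₃.start_mem_support)
    · exact Or.inr (Or.inr hx)
  have hedges : ∀ f, e₀ ≠ f → w.edges.Disjoint (D.route f).edges := by
    intro f hf s hs hs'
    simp only [hw, Walk.edges_append, List.mem_append] at hs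
    have hmem : s ∈ p₁.edges ∨ s ∈ p₃.edges → False := by
      intro h
      refine D.edges_disjoint e₀ f hf (a := s) ?_ hs'
      rw [heq]
      simp only [Walk.edges_append, List.mem_append]
      tauto
    rcases hs with hs | hs | hs
    · exact hmem (Or.inl hs)
    · obtain ⟨x, hx, hxW⟩ := exists_notMem_of_mem_edges hq hlen hqD hs
      exact hxW (hverts f x (Walk.mem_support_of_mem_edges hs' hx))
    · exact hmem (Or.inr hs)
  let route' : ∀ e, G.Walk (D.branch (D.tail e)) (D.branch (D.head e)) :=
    Function.update D.route e₀ w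
  have hr0 : route' e₀ = w := Function.update_self ..
  have hr : ∀ e, e ≠ e₀ → route' e = D.route e := fun e he => Function.update_of_ne he ..
  refine ⟨⟨D.branch, D.branch_injective, D.tail, D.head, D.isLink, route', ?_, ?_, ?_, ?_, ?_⟩, ?_⟩
  · intro e he
    by_cases h : e = e₀
    · subst h
      rw [hr0]
      exact isPath_replace (heq ▸ D.isPath_of_ne e he) hab hq hqw
    · rw [hr e h]
      exact D.isPath_of_ne e he
  · intro e he
    by_cases h : e = e₀
    · subst h
      have := D.isCycle_of_eq e he
      rw [heq] at this
      rw [hr0]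
      exact isCycle_replace _ this hab hq hlen hqw
    · rw [hr e h]
      exact D.isCycle_of_eq e he
  · intro e x hx
    by_cases h : e = e₀
    · subst h
      rw [hr0] at hx
      exact D.branch_mem_route e x (hold _ hx (hbranch x))
    · rw [hr e h] at hx
      exact D.branch_mem_route e x hx
  · intro e f hef x hx hx'
    by_cases h : e = e₀
    · subst h
      rw [hr0] at hx
      rw [hr f hef.symm] at hx'
      exact D.route_inter_route e f hef x (hold x hx (hverts f x hx')) hx'
    · rw [hr e h] at hx
      by_cases h' : f = e₀
      · subst h'
        rw [hr0] at hx'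
        exact D.route_inter_route e f hef x hx (hold x hx' (hverts e x hx))
      · rw [hr f h'] at hx'
        exact D.route_inter_route e f hef x hx hx'
  · intro e f hef
    by_cases h : e = e₀
    · subst h
      rw [hr0, hr f hef.symm]
      exact hedges f hef
    · rw [hr e h]
      by_cases h' : f = e₀
      · subst h'
        rw [hr0]
        exact (hedges e hef.symm).symm
      · rw [hr f h']
        exact D.edges_disjoint e f hef
  · show ∑ e, (route' e).length + p₂.length = _
    rw [← Finset.add_sum_erase _ _ (Finset.mem_univ e₀),
      ← Finset.add_sum_erase _ (fun e => (D.route e).length) (Finset.mem_univ e₀), hr0]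
    rw [Finset.sum_congr rfl (g := fun e => (D.route e).length)
      fun e he => by rw [hr e (Finset.ne_of_mem_erase he)]]
    simp only [heq, hw, Walk.length_append]
    omega

/-- Distinct routes share no vertices other than branch vertices, and a route, even of a loop, has
at most one edge more than it has non-branch vertices. -/
lemma Subdivision.sum_length_le [Fintype V] [Fintype M.edgeSet] (D : Subdivision M G) :
    ∑ e, (D.route e).length ≤ Fintype.card V + Fintype.card M.edgeSet := by
  classical
  let I : M.edgeSet → Finset V := fun e =>
    (D.route e).support.toFinset.filter fun x => x ∉ Set.range D.branch
  have hI : ∀ e, (D.route e).length ≤ (I e).card + 1 := by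
    intro e
    have h1 := Finset.card_filter_add_card_filter_not (s := (D.route e).support.toFinset)
      (fun x => x ∈ Set.range D.branch)
    by_cases h : D.tail e = D.head e
    · have h2 : (D.route e).length ≤ (D.route e).support.toFinset.card := by
        have h3 := ((isCycle_copy_iff _ _).1 (D.isCycle_of_eq e h)).2.2
        have h4 : (D.route e).support.tail.length = (D.route e).length := by
          simp [List.length_tail]
        rw [← h4, ← List.toFinset_card_of_nodup h3]
        refine Finset.card_le_card fun x hx => ?_
        simp only [List.mem_toFinset] at hx ⊢
        exact List.mem_of_mem_tail hx
      have h4 : ((D.route e).support.toFinset.filter fun x => x ∈ Set.range D.branch).card ≤ 1 := by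
        rw [← Finset.card_singleton (D.branch (D.tail e))]
        refine Finset.card_le_card fun x hx => ?_
        simp only [Finset.mem_filter, List.mem_toFinset] at hx
        obtain ⟨hx, y, rfl⟩ := hx
        rcases D.branch_mem_route e y hx with rfl | rfl
        · simp
        · simp [h]
      simp only [I]
      omega
    · have h2 : (D.route e).support.toFinset.card = (D.route e).length + 1 := by
        rw [List.toFinset_card_of_nodup (D.isPath_of_ne e h).support_nodup, Walk.length_support]
      have h4 : ((D.route e).support.toFinset.filter fun x => x ∈ Set.range D.branch).card ≤ 2 := by
        refine le_trans (Finset.card_le_card (t := {D.branch (D.tail e), D.branch (D.head e)})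
          fun x hx => ?_) Finset.card_le_two
        simp only [Finset.mem_filter, List.mem_toFinset] at hx
        obtain ⟨hx, y, rfl⟩ := hx
        rcases D.branch_mem_route e y hx with rfl | rfl <;> simp
      simp only [I]
      omega
  calc ∑ e, (D.route e).length ≤ ∑ e, ((I e).card + 1) := Finset.sum_le_sum fun e _ => hI e
    _ = (Finset.univ.biUnion I).card + Fintype.card M.edgeSet := by
      rw [Finset.sum_add_distrib, Finset.card_biUnion]
      · simp
      · intro e _ f _ hef
        rw [Function.onFun, Finset.disjoint_left]
        intro x hx hx'
        simp only [I, Finset.mem_filter, List.mem_toFinset] at hx hx'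
        exact hx.2 (D.route_inter_route e f hef x hx.1 hx'.1)
    _ ≤ _ := Nat.add_le_add_right (Finset.card_le_univ _) _

/-- The cycle of a loop keeps all its vertices when its first edge is dropped; so the rank argument
need only treat paths. -/
lemma Subdivision.exists_path_route (D : Subdivision M G) (e : M.edgeSet) :
    ∃ a b : V, ∃ p : G.Walk a b, p.IsPath ∧ ∀ x, x ∈ p.support ↔ x ∈ (D.route e).support := by
  by_cases h : D.tail e = D.head e
  · have hc := D.isCycle_of_eq e h
    refine ⟨_, _, _, hc.isPath_tail, fun x => ?_⟩
    rw [Walk.support_tail_of_not_nil _ hc.not_nil]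
    have h1 : ∀ y, y ∈ ((D.route e).copy rfl (congrArg D.branch h.symm)).support ↔
        y ∈ (D.route e).support := fun y => by rw [Walk.support_copy]
    rw [← h1, Walk.mem_support_iff _]
    constructor
    · exact Or.inr
    · rintro (rfl | hx)
      · exact Walk.end_mem_tail_support hc.not_nil
      · exact hx
  · exact ⟨_, _, _, D.isPath_of_ne e h, fun x => Iff.rfl⟩

lemma Subdivision.isLink_cases (D : Subdivision M G) {e : β} {x y : α} (h : M.IsLink e x y) :
    ∃ e' : M.edgeSet, ((D.tail e' : α) = x ∧ (D.head e' : α) = y) ∨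
      ((D.tail e' : α) = y ∧ (D.head e' : α) = x) :=
  ⟨⟨e, h.edge_mem⟩, (D.isLink ⟨e, h.edge_mem⟩).eq_and_eq_or_eq_and_eq h⟩

/-- In a subdivision of a connected multigraph with an edge, the subdivided edges cover all
vertices. -/
lemma Subdivision.exists_mem_route (D : Subdivision M G) (hM : IsConnected M)
    (hE : M.edgeSet.Nonempty) {x : V} (hx : x ∈ D.toSubgraph.verts) :
    ∃ e, x ∈ (D.route e).support := by
  rcases (D.mem_verts x).1 hx with ⟨⟨y, hy⟩, rfl⟩ | h
  swap
  · exact h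
  have hlink : ∃ e z, M.IsLink e y z := by
    obtain ⟨e, he⟩ := hE
    obtain ⟨u, v, huv⟩ := (M.edge_mem_iff_exists_isLink e).1 he
    rcases (hM.2 y hy u huv.left_mem).cases_head with rfl | ⟨c, ⟨f, hf⟩, -⟩
    · exact ⟨e, v, huv⟩
    · exact ⟨f, c, hf⟩
  obtain ⟨e, z, h⟩ := hlink
  obtain ⟨e', ⟨h1, -⟩ | ⟨-, h1⟩⟩ := D.isLink_cases h
  · have : D.tail e' = ⟨y, hy⟩ := Subtype.ext h1
    exact ⟨e', this ▸ (D.route e').start_mem_support⟩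
  · have : D.head e' = ⟨y, hy⟩ := Subtype.ext h1
    exact ⟨e', this ▸ (D.route e').end_mem_support⟩

lemma Subdivision.exists_walk (D : Subdivision M G) (hM : IsConnected M) {u v : V}
    (hu : u ∈ D.toSubgraph.verts) (hv : v ∈ D.toSubgraph.verts) :
    ∃ p : G.Walk u v, ∀ x ∈ p.support, x ∈ D.toSubgraph.verts := by
  classical
  let C : V → V → Prop := fun u v => ∃ p : G.Walk u v, ∀ x ∈ p.support, x ∈ D.toSubgraph.verts
  have hsymm : ∀ {u v}, C u v → C v u := by
    rintro u v ⟨p, hp⟩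
    exact ⟨p.reverse, fun x hx => hp x (by simpa using hx)⟩
  have htrans : ∀ {u v w}, C u v → C v w → C u w := by
    rintro u v w ⟨p, hp⟩ ⟨q, hq⟩
    exact ⟨p.append q, fun x hx => ((Walk.mem_support_append_iff _ _).1 hx).elim (hp x) (hq x)⟩
  have hrefl : ∀ {u}, u ∈ D.toSubgraph.verts → C u u := fun hu => ⟨.nil, by simpa using hu⟩
  have hverts : ∀ e, ∀ x ∈ (D.route e).support, x ∈ D.toSubgraph.verts := fun e x hx =>
    (D.mem_verts x).2 (Or.inr ⟨e, hx⟩)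
  have hbranch : ∀ x, D.branch x ∈ D.toSubgraph.verts := fun x =>
    (D.mem_verts _).2 (Or.inl ⟨x, rfl⟩)
  have hCbranch : ∀ x (hx : x ∈ M.vertexSet) y (hy : y ∈ M.vertexSet),
      C (D.branch ⟨x, hx⟩) (D.branch ⟨y, hy⟩) := by
    intro x hx y hy
    have hxy := hM.2 x hx y hy
    induction hxy with
    | refl => exact hrefl (hbranch _)
    | @tail y z _ hyz ih =>
      obtain ⟨f, hf⟩ := hyz
      refine htrans (ih hf.left_mem) ?_
      obtain ⟨e, ⟨h1, h2⟩ | ⟨h1, h2⟩⟩ := D.isLink_cases hf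
      · have h3 : D.tail e = ⟨y, hf.left_mem⟩ := Subtype.ext h1
        have h4 : D.head e = ⟨z, hy⟩ := Subtype.ext h2
        rw [← h3, ← h4]
        exact ⟨D.route e, hverts e⟩
      · have h3 : D.tail e = ⟨z, hy⟩ := Subtype.ext h1
        have h4 : D.head e = ⟨y, hf.left_mem⟩ := Subtype.ext h2
        rw [← h3, ← h4]
        exact hsymm ⟨D.route e, hverts e⟩
  have key : ∀ u ∈ D.toSubgraph.verts, ∃ x, C (D.branch x) u := by
    intro u hu
    rcases (D.mem_verts u).1 hu with ⟨x, rfl⟩ | ⟨e, he⟩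
    · exact ⟨x, hrefl hu⟩
    · exact ⟨D.tail e, (D.route e).takeUntil u he, fun x hx =>
        hverts e x (Walk.support_takeUntil_subset_support _ _ hx)⟩
  obtain ⟨x, hx⟩ := key u hu
  obtain ⟨y, hy⟩ := key v hv
  exact htrans (hsymm hx) (htrans (hCbranch x x.2 y y.2) hy)

lemma isBramble_maxSubdivisions (hM : IsConnected M)
    (hL : PairwiseIntersecting (maxSubdivisions M G)) :
    IsBramble G (Subgraph.verts '' maxSubdivisions M G) := by
  refine ⟨?_, ?_⟩
  · rintro _ ⟨_, ⟨⟨D, rfl⟩, -⟩, rfl⟩ u hu v hv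
    exact D.exists_walk hM hu hv
  · rintro _ ⟨Q, hQ, rfl⟩ _ ⟨R, hR, rfl⟩
    exact hL Q hQ R hR

lemma tau_le {S : Finset V} (hS : IsTransversal (maxSubdivisions M G) S) : tau M G ≤ S.card :=
  Nat.sInf_le ⟨S, hS, rfl⟩

lemma tau_le_card [Fintype V] (hL : PairwiseIntersecting (maxSubdivisions M G)) :
    tau M G ≤ Fintype.card V :=
  tau_le (S := Finset.univ) fun Q hQ => by
    obtain ⟨v, hv, -⟩ := hL Q hQ Q hQ
    exact ⟨v, Finset.mem_univ v, hv⟩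

/-- A connected multigraph without edges has only one vertex. -/
lemma tau_le_one [Finite V] (hM : IsConnected M) (hE : M.edgeSet = ∅)
    (hL : PairwiseIntersecting (maxSubdivisions M G)) : tau M G ≤ 1 := by
  classical
  rcases (maxSubdivisions M G).eq_empty_or_nonempty with h | ⟨Q, hQ⟩
  · refine (tau_le (S := ∅) ?_).trans (by simp)
    simp [IsTransversal, h]
  obtain ⟨x, hx⟩ := hM.1
  obtain ⟨⟨D, rfl⟩, hmax⟩ := id hQ
  have huniq : ∀ y : M.vertexSet, y = ⟨x, hx⟩ := by
    rintro ⟨y, hy⟩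
    rcases (hM.2 y hy x hx).cases_head with rfl | ⟨c, ⟨f, hf⟩, -⟩
    · rfl
    · exact absurd hf.edge_mem (by simp [hE])
  have hmem : ∀ v ∈ D.toSubgraph.verts, v = D.branch ⟨x, hx⟩ := by
    intro v hv
    rcases (D.mem_verts v).1 hv with ⟨y, rfl⟩ | ⟨⟨e, he⟩, -⟩
    · rw [huniq y]
    · simp [hE] at he
  refine (tau_le (S := {D.branch ⟨x, hx⟩}) fun R hR => ?_).trans (by simp)
  obtain ⟨v, hv, hvR⟩ := hL _ hQ R hR
  exact ⟨v, by simp [hmem v hv], hvR⟩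

theorem tau_le_max [Fintype V] (hMfin : M.edgeSet.Finite) (hM : IsConnected M)
    (hL : PairwiseIntersecting (maxSubdivisions M G))
    (hn : M.edgeSet.ncard ^ 3 < Fintype.card V) :
    (tau M G : ℝ) ≤ max (5 * (Fintype.card V : ℝ) ^ ((2 : ℝ) / 3))
      (2 * (M.edgeSet.ncard : ℝ) ^ 2 * (Fintype.card V : ℝ) ^ ((1 : ℝ) / 3)) := by
  classical
  have hpos : 1 ≤ Fintype.card V := by omega
  rcases M.edgeSet.eq_empty_or_nonempty with hE | hE
  · refine le_max_of_le_left ?_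
    have h1 : (tau M G : ℝ) ≤ 1 := by exact_mod_cast tau_le_one hM hE hL
    have h2 : (1 : ℝ) ≤ (Fintype.card V : ℝ) ^ ((2 : ℝ) / 3) :=
      Real.one_le_rpow (by exact_mod_cast hpos) (by norm_num)
    linarith
  have : Fintype M.edgeSet := hMfin.fintype
  have hcard : Fintype.card M.edgeSet = M.edgeSet.ncard := by
    rw [← Nat.card_eq_fintype_card, Nat.card_coe_set_eq]
  obtain ⟨S, hS, hSc⟩ := (isBramble_maxSubdivisions hM hL).exists_transversal hcard
    ((Set.ncard_pos hMfin).2 hE) hn (by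
      rintro _ ⟨_, ⟨⟨D, rfl⟩, -⟩, rfl⟩
      choose a b p hp hsupp using D.exists_path_route
      refine ⟨a, b, p, hp, Set.ext fun x => ?_⟩
      simp only [Set.mem_iUnion, Set.mem_ofPred_eq, hsupp]
      exact ⟨D.exists_mem_route hM hE, fun h => (D.mem_verts x).2 (Or.inr h)⟩) (by
      rintro _ ⟨_, ⟨⟨D, rfl⟩, hmax⟩, rfl⟩ w c hc hcR z g ⟨L⟩ hg hgc
      have key := L.card_mul_le D.route (fun x hx => D.exists_mem_route hM hE hx) (by
        intro e a b hab p₁ p₂ p₃ heq q hq hlen hqR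
        obtain ⟨D', hD'⟩ := D.exists_replace e hab p₁ p₂ p₃ heq q hq hlen hqR
        have := hmax _ ⟨D', rfl⟩
        rw [D.ncard_edgeSet, D'.ncard_edgeSet] at this
        omega) c hc hcR hg hgc
      have h1 := D.sum_length_le
      rw [hcard] at key h1
      omega)
  refine le_trans ?_ hSc
  exact_mod_cast tau_le fun Q hQ => hS _ ⟨Q, hQ, rfl⟩

/-- From m⁶ ≤ n follows m² ≤ n^(1/3), so the second term is at most 2n^(2/3). The condition m³ < n
can fail only for n ≤ 1, which the small case covers. -/
theorem tau_le_of_pow_six_le [Fintype V] (hMfin : M.edgeSet.Finite) (hM : IsConnected M)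
    (hL : PairwiseIntersecting (maxSubdivisions M G))
    (hn : M.edgeSet.ncard ^ 6 ≤ Fintype.card V) :
    (tau M G : ℝ) ≤ 5 * (Fintype.card V : ℝ) ^ ((2 : ℝ) / 3) := by
  by_cases hsmall : Fintype.card V ≤ 125
  · have h1 : (tau M G : ℝ) ≤ Fintype.card V := by exact_mod_cast tau_le_card hL
    exact h1.trans (le_five_mul_rpow hsmall)
  push Not at hsmall
  set m := M.edgeSet.ncard with hm
  have hlt : m ^ 3 < Fintype.card V := by
    by_contra! hc
    have h1 : (m ^ 3) * (m ^ 3) ≤ Fintype.card V := by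
      calc m ^ 3 * m ^ 3 = m ^ 6 := by ring
        _ ≤ _ := hn
    nlinarith
  refine (tau_le_max hMfin hM hL hlt).trans (max_le le_rfl ?_)
  rw [← rpow_third_sq, ← hm]
  have h3 := rpow_third_cube (Fintype.card V)
  set N := (Fintype.card V : ℝ) ^ ((1 : ℝ) / 3)
  have hN0 : 0 ≤ N := by positivity
  have hmN : (m : ℝ) ^ 2 ≤ N := by
    by_contra! hc
    have h1 : N ^ 3 < ((m : ℝ) ^ 2) ^ 3 := by gcongr
    have h2 : ((m ^ 6 : ℕ) : ℝ) ≤ Fintype.card V := by exact_mod_cast hn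
    push_cast at h2
    rw [h3, ← pow_mul] at h1
    norm_num at h1
    linarith
  nlinarith [mul_le_mul_of_nonneg_right hmN hN0]

end Subdivisions

end MSub

theorem theorem2 {V : Type*} [Fintype V] (G : SimpleGraph V) :
    (∀ (α β : Type*) (M : Graph α β),
      M.vertexSet.Finite → M.edgeSet.Finite → MSub.IsConnected M →
      MSub.PairwiseIntersecting (MSub.maxSubdivisions M G) →
        (M.edgeSet.ncard ^ 3 < Fintype.card V →
          (MSub.tau M G : ℝ) ≤ max (5 * (Fintype.card V : ℝ) ^ ((2 : ℝ) / 3))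
            (2 * (M.edgeSet.ncard : ℝ) ^ 2 * (Fintype.card V : ℝ) ^ ((1 : ℝ) / 3))) ∧
        (M.edgeSet.ncard ^ 6 ≤ Fintype.card V →
          (MSub.tau M G : ℝ) ≤ 5 * (Fintype.card V : ℝ) ^ ((2 : ℝ) / 3))) ∧
    (G.Connected →
      ∃ S : Finset V, (S.card : ℝ) ≤ 5 * (Fintype.card V : ℝ) ^ ((2 : ℝ) / 3) ∧
        ∀ (u v : V) (p : G.Walk u v), p.IsPath →
          (∀ (u' v' : V) (q : G.Walk u' v'), q.IsPath → q.length ≤ p.length) →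
          ∃ x ∈ S, x ∈ p.support) :=
  ⟨fun _ _ _ _ hE hM hL => ⟨MSub.tau_le_max hE hM hL, MSub.tau_le_of_pow_six_le hE hM hL⟩,
    MSub.exists_transversal_longestPaths⟩
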